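/- **Theorem.** Let $J^2=\mathbb R^8$ have coordinates $(x,y,z,p,q,r,s,t)$, and put $\varpi_0=dz-p\,dx-q\,dy$, $\varpi_1=dp-r\,dx-s\,dy$, $\varpi_2=dq-s\,dx-t\,dy$. Let $F$ be a smooth real function on an open set $\Omega\subset J^2$ such that at every point of $R=\{w\in\Omega : F(w)=0\}$ one has $(F_r,F_s,F_t)\neq(0,0,0)$ and $\Delta=F_rF_t-F_s^2/4<0$ (that is, $R$ is a regular second-order equation that is hyperbolic at each of its points). Then $R$ is a smooth hypersurface, and it carries the rank $4$ distribution $D=\{\varpi_0|_R=\varpi_1|_R=\varpi_2|_R=0\}\subset TR$. Let $J(D,2)$ be the Grassmann bundle over $R$ of all pairs $(w,v)$ with $w\in R$ and $v$ a $2$-dimensional linear subspace of $D(w)$; it is an $11$-dimensional smooth submanifold of the Grassmann bundle $J^2\times \mathrm{Gr}(2,\mathbb R^8)$ of tangent planes of $J^2$. Let the rank $2$ prolongation $\Sigma(R)$ be the set of all $(w,v)$ such that $w\in R$ and $v\subset T_wR$ is a $2$-dimensional integral element of $D$, i.e. $\varpi_i|_v=0$ and $d\varpi_i|_v=0$ for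 $i=0,1,2$. Then $\Sigma(R)$ is a smooth (embedded, $9$-dimensional) submanifold of $J(D,2)$, and the projection $p:\Sigma(R)\to R$, $(w,v)\mapsto w$, is a smooth locally trivial fibre bundle with fibre the torus $T^2=S^1\times S^1$. -/

import Mathlib

open scoped Manifold ContDiff
open Manifold

namespace JetPDE

noncomputable section

/-- The second jet space of functions of two variables, with coordinates
`(x, y, z, p, q, r, s, t)` numbered `0, …, 7`. -/
abbrev J2 : Type := EuclideanSpace ℝ (Fin 8)

abbrev E2 : Type := EuclideanSpace ℝ (Fin 2)

abbrev E6 : Type := EuclideanSpace ℝ (Fin 6)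

/-! ### The Grassmann manifold of planes in `J2` -/

/-- The Grassmann manifold `Gr(J2, 2)` of two-dimensional linear subspaces. -/
def Plane : Type := {v : Submodule ℝ J2 // Module.finrank ℝ v = 2}

/-- In linear coordinates `e : J2 ≃ ℝ² × ℝ⁶`, the graph of `T : ℝ² → ℝ⁶`. -/
def planeGraph (e : J2 ≃L[ℝ] E2 × E6) (T : E2 →L[ℝ] E6) : Submodule ℝ J2 where
  carrier := {x | (e x).2 = T (e x).1}
  add_mem' := by
    intro a b ha hb
    simp only [Set.mem_ofPred_eq] at *
    simp [ha, hb]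
  zero_mem' := by simp
  smul_mem' := by
    intro c a ha
    simp only [Set.mem_ofPred_eq] at *
    simp [ha]

theorem mem_planeGraph {e : J2 ≃L[ℝ] E2 × E6} {T : E2 →L[ℝ] E6} {x : J2} :
    x ∈ planeGraph e T ↔ (e x).2 = T (e x).1 := Iff.rfl

theorem symm_mem_planeGraph (e : J2 ≃L[ℝ] E2 × E6) (T : E2 →L[ℝ] E6) (x : E2) :
    e.symm (x, T x) ∈ planeGraph e T := by
  simp [mem_planeGraph]

theorem finrank_planeGraph (e : J2 ≃L[ℝ] E2 × E6) (T : E2 →L[ℝ] E6) :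
    Module.finrank ℝ (planeGraph e T) = 2 := by
  let f : planeGraph e T ≃ₗ[ℝ] E2 :=
    { toFun := fun x => (e x.1).1
      map_add' := by intro a b; simp
      map_smul' := by intro a b; simp
      invFun := fun x => ⟨e.symm (x, T x), symm_mem_planeGraph e T x⟩
      left_inv := by
        rintro ⟨x, hx⟩
        apply Subtype.ext
        have hx' := mem_planeGraph.1 hx
        apply e.injective
        simp [← hx']
      right_inv := by intro x; simp }
  rw [f.finrank_eq]
  simp

theorem planeGraph_injective (e : J2 ≃L[ℝ] E2 × E6) :
    Function.Injective (planeGraph e) := by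
  intro T T' h
  ext1 x
  have hx := symm_mem_planeGraph e T x
  rw [h, mem_planeGraph] at hx
  simpa using hx

/-- The inhomogeneous Grassmann coordinates attached to `e`: their domain is the set of planes
that are graphs over `ℝ²`, and the coordinate of the graph of `T` is `T`. -/
def planeChart (e : J2 ≃L[ℝ] E2 × E6) : PartialEquiv Plane (E2 →L[ℝ] E6) where
  toFun v := Classical.epsilon fun T => v.1 = planeGraph e T
  invFun T := ⟨planeGraph e T, finrank_planeGraph e T⟩
  source := {v | ∃ T, v.1 = planeGraph e T}
  target := Set.univ
  map_source' := fun _ _ => Set.mem_univ _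
  map_target' := fun T _ => ⟨T, rfl⟩
  left_inv' := fun _ hv => Subtype.ext (Classical.epsilon_spec hv).symm
  right_inv' := fun T _ => planeGraph_injective e
    (Classical.epsilon_spec (p := fun T' => planeGraph e T = planeGraph e T') ⟨T, rfl⟩).symm

theorem planeChart_apply {e : J2 ≃L[ℝ] E2 × E6} {v : Plane} {T : E2 →L[ℝ] E6}
    (h : v.1 = planeGraph e T) : planeChart e v = T :=
  planeGraph_injective e ((Classical.epsilon_spec
    (p := fun T' => v.1 = planeGraph e T') ⟨T, h⟩).symm.trans h)

theorem exists_planeChart (v : Plane) : ∃ e : J2 ≃L[ℝ] E2 × E6, v ∈ (planeChart e).source := by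
  obtain ⟨w, hw⟩ := Submodule.exists_isCompl v.1
  have h2 : Module.finrank ℝ v.1 = 2 := v.2
  have h6 : Module.finrank ℝ w = 6 := by
    have h := Submodule.finrank_add_eq_of_isCompl hw
    rw [h2] at h
    simp only [finrank_euclideanSpace, Fintype.card_fin] at h
    omega
  let a : v.1 ≃ₗ[ℝ] E2 := LinearEquiv.ofFinrankEq _ _ (by rw [h2]; simp)
  let b : w ≃ₗ[ℝ] E6 := LinearEquiv.ofFinrankEq _ _ (by rw [h6]; simp)
  let e : J2 ≃ₗ[ℝ] E2 × E6 := (Submodule.prodEquivOfIsCompl v.1 w hw).symm.trans (a.prodCongr b)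
  refine ⟨e.toContinuousLinearEquiv, 0, ?_⟩
  ext x
  rw [mem_planeGraph]
  have : (e.toContinuousLinearEquiv x).2 = b ((Submodule.prodEquivOfIsCompl v.1 w hw).symm x).2 :=
    rfl
  rw [this]
  simp

/-- The first block `T ↦ a + b T` of a change of Grassmann coordinates. -/
def transFst (e e' : J2 ≃L[ℝ] E2 × E6) (T : E2 →L[ℝ] E6) : E2 →L[ℝ] E2 :=
  (ContinuousLinearMap.fst ℝ E2 E6 ∘L (e.symm.trans e' : E2 × E6 →L[ℝ] E2 × E6)) ∘L
    (ContinuousLinearMap.inl ℝ E2 E6 + ContinuousLinearMap.inr ℝ E2 E6 ∘L T)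

/-- The second block `T ↦ c + d T` of a change of Grassmann coordinates. -/
def transSnd (e e' : J2 ≃L[ℝ] E2 × E6) (T : E2 →L[ℝ] E6) : E2 →L[ℝ] E6 :=
  (ContinuousLinearMap.snd ℝ E2 E6 ∘L (e.symm.trans e' : E2 × E6 →L[ℝ] E2 × E6)) ∘L
    (ContinuousLinearMap.inl ℝ E2 E6 + ContinuousLinearMap.inr ℝ E2 E6 ∘L T)

theorem transFst_apply (e e' : J2 ≃L[ℝ] E2 × E6) (T : E2 →L[ℝ] E6) (x : E2) :
    transFst e e' T x = (e' (e.symm (x, T x))).1 := by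
  have h : ContinuousLinearMap.inl ℝ E2 E6 x + ContinuousLinearMap.inr ℝ E2 E6 (T x) = (x, T x) := by
    simp
  simp only [transFst, ContinuousLinearMap.comp_apply, add_apply, h]
  rfl

theorem transSnd_apply (e e' : J2 ≃L[ℝ] E2 × E6) (T : E2 →L[ℝ] E6) (x : E2) :
    transSnd e e' T x = (e' (e.symm (x, T x))).2 := by
  have h : ContinuousLinearMap.inl ℝ E2 E6 x + ContinuousLinearMap.inr ℝ E2 E6 (T x) = (x, T x) := by
    simp
  simp only [transSnd, ContinuousLinearMap.comp_apply, add_apply, h]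
  rfl

theorem contDiff_transFst (e e' : J2 ≃L[ℝ] E2 × E6) : ContDiff ℝ ∞ (transFst e e') :=
  contDiff_const.clm_comp (contDiff_const.add (contDiff_const.clm_comp contDiff_id))

theorem contDiff_transSnd (e e' : J2 ≃L[ℝ] E2 × E6) : ContDiff ℝ ∞ (transSnd e e') :=
  contDiff_const.clm_comp (contDiff_const.add (contDiff_const.clm_comp contDiff_id))

theorem planeGraph_eq_of_isUnit (e e' : J2 ≃L[ℝ] E2 × E6) (T : E2 →L[ℝ] E6)
    (h : IsUnit (transFst e e' T)) :
    planeGraph e T = planeGraph e' (transSnd e e' T ∘L Ring.inverse (transFst e e' T)) := by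
  apply Submodule.eq_of_le_of_finrank_eq
  · intro y hy
    rw [mem_planeGraph] at hy ⊢
    have hy' : y = e.symm ((e y).1, T (e y).1) := by rw [← hy]; simp
    have h1 : (e' y).1 = transFst e e' T (e y).1 := by rw [transFst_apply, ← hy']
    have h2 : (e' y).2 = transSnd e e' T (e y).1 := by rw [transSnd_apply, ← hy']
    have h3 : Ring.inverse (transFst e e' T) (transFst e e' T (e y).1) = (e y).1 := by
      have := Ring.inverse_mul_cancel _ h
      exact DFunLike.congr_fun this (e y).1
    rw [h1, h2, ContinuousLinearMap.comp_apply, h3]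
  · rw [finrank_planeGraph, finrank_planeGraph]

theorem isUnit_of_planeGraph_eq (e e' : J2 ≃L[ℝ] E2 × E6) (T T' : E2 →L[ℝ] E6)
    (h : planeGraph e T = planeGraph e' T') : IsUnit (transFst e e' T) := by
  have key : ∀ x, transSnd e e' T x = T' (transFst e e' T x) := by
    intro x
    have hx := symm_mem_planeGraph e T x
    rw [h, mem_planeGraph] at hx
    rw [transFst_apply, transSnd_apply, hx]
  have hinj : Function.Injective (transFst e e' T) := by
    rw [injective_iff_map_eq_zero]
    intro x hx
    have h2 := key x
    rw [hx, map_zero] at h2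
    rw [transFst_apply] at hx
    rw [transSnd_apply] at h2
    have h3 : e' (e.symm (x, T x)) = 0 := Prod.ext hx h2
    have h4 : (x, T x) = (0 : E2 × E6) := by simpa using h3
    exact congrArg Prod.fst h4
  let f : E2 ≃ₗ[ℝ] E2 := LinearEquiv.ofInjectiveEndo (transFst e e' T).toLinearMap hinj
  refine ⟨(ContinuousLinearEquiv.unitsEquiv ℝ E2).symm f.toContinuousLinearEquiv, ?_⟩
  ext1 x
  rfl

theorem trans_source (e e' : J2 ≃L[ℝ] E2 × E6) :
    ((planeChart e).symm.trans (planeChart e')).source = {T | IsUnit (transFst e e' T)} := by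
  ext T
  simp only [PartialEquiv.trans_source, PartialEquiv.symm_source, Set.mem_inter_iff,
    Set.mem_preimage, Set.mem_ofPred_eq]
  constructor
  · rintro ⟨-, T', hT'⟩
    exact isUnit_of_planeGraph_eq e e' T T' hT'
  · intro h
    exact ⟨Set.mem_univ _, _, planeGraph_eq_of_isUnit e e' T h⟩

theorem contDiffOn_trans (e e' : J2 ≃L[ℝ] E2 × E6) :
    ContDiffOn ℝ ∞ ((planeChart e).symm.trans (planeChart e'))
      ((planeChart e).symm.trans (planeChart e')).source := by
  rw [trans_source]
  have h1 : ContDiffOn ℝ ∞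
      (fun T => transSnd e e' T ∘L Ring.inverse (transFst e e' T))
      {T | IsUnit (transFst e e' T)} := by
    intro T hT
    obtain ⟨u, hu⟩ := hT
    have h2 : ContDiffAt ℝ ∞ (fun T => Ring.inverse (transFst e e' T)) T := by
      refine ContDiffAt.comp T (g := Ring.inverse) ?_ (contDiff_transFst e e').contDiffAt
      rw [← hu]
      exact contDiffAt_ringInverse ℝ u
    exact ((contDiff_transSnd e e').contDiffAt.clm_comp h2).contDiffWithinAt
  refine h1.congr fun T hT => ?_
  exact planeChart_apply (planeGraph_eq_of_isUnit e e' T hT)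

/-- The atlas of all inhomogeneous Grassmann coordinates. -/
def planeCore : ChartedSpaceCore (E2 →L[ℝ] E6) Plane where
  atlas := Set.range planeChart
  chartAt v := planeChart (exists_planeChart v).choose
  mem_chart_source v := (exists_planeChart v).choose_spec
  chart_mem_atlas v := Set.mem_range_self _
  open_source := by
    rintro _ _ ⟨e, rfl⟩ ⟨e', rfl⟩
    rw [trans_source]
    exact Units.isOpen.preimage (contDiff_transFst e e').continuous
  continuousOn_toFun := by
    rintro _ _ ⟨e, rfl⟩ ⟨e', rfl⟩
    exact (contDiffOn_trans e e').continuousOn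

instance : TopologicalSpace Plane := planeCore.toTopologicalSpace

instance : ChartedSpace (E2 →L[ℝ] E6) Plane := planeCore.toChartedSpace

instance : IsManifold 𝓘(ℝ, E2 →L[ℝ] E6) ∞ Plane := by
  apply isManifold_of_contDiffOn
  intro c c' hc hc'
  change c ∈ ⋃ (e : PartialEquiv Plane (E2 →L[ℝ] E6)) (he : e ∈ planeCore.atlas),
    {planeCore.openPartialHomeomorph e he} at hc
  change c' ∈ ⋃ (e : PartialEquiv Plane (E2 →L[ℝ] E6)) (he : e ∈ planeCore.atlas),
    {planeCore.openPartialHomeomorph e he} at hc'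
  simp only [Set.mem_iUnion, Set.mem_singleton_iff] at hc hc'
  obtain ⟨_, ⟨e, rfl⟩, rfl⟩ := hc
  obtain ⟨_, ⟨e', rfl⟩, rfl⟩ := hc'
  have h := contDiffOn_trans e e'
  simp only [modelWithCornersSelf_coe, modelWithCornersSelf_coe_symm, Function.id_comp,
    Function.comp_id, Set.preimage_id, Set.range_id, Set.inter_univ]
  exact h

/-! ### Second order equations -/

/-- The coordinate one-form `dx_i` on `J2`, as a constant covector. -/
def dcoord (i : Fin 8) : J2 →L[ℝ] ℝ := EuclideanSpace.proj i

/-- The contact forms `ϖ₀ = dz - p dx - q dy`, `ϖ₁ = dp - r dx - s dy`, `ϖ₂ = dq - s dx - t dy`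
on `J2`, as covectors depending on the point. -/
def contactCovector (i : Fin 3) (w : J2) : J2 →L[ℝ] ℝ :=
  ![dcoord 2 - w 3 • dcoord 0 - w 4 • dcoord 1,
    dcoord 3 - w 5 • dcoord 0 - w 6 • dcoord 1,
    dcoord 4 - w 6 • dcoord 0 - w 7 • dcoord 1] i

/-- The contact forms as differential one-forms. -/
def contactForm (i : Fin 3) (w : J2) : J2 [⋀^Fin 1]→L[ℝ] ℝ :=
  ContinuousAlternatingMap.ofSubsingleton ℝ J2 ℝ 0 (contactCovector i w)

/-- The equation `R = {F = 0}`, for `F` a function on an open set `Ω` of `J2`. -/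
def equation (Ω : Set J2) (F : J2 → ℝ) : Set J2 := {w | w ∈ Ω ∧ F w = 0}

/-- The partial derivative of `F` in the `i`-th coordinate. -/
def partialDeriv (F : J2 → ℝ) (i : Fin 8) (w : J2) : ℝ :=
  fderiv ℝ F w (EuclideanSpace.single i 1)

/-- The discriminant `Δ = F_r F_t - F_s² / 4`. -/
def discriminant (F : J2 → ℝ) (w : J2) : ℝ :=
  partialDeriv F 5 w * partialDeriv F 7 w - partialDeriv F 6 w ^ 2 / 4

/-- The regularity condition `(F_r, F_s, F_t) ≠ (0, 0, 0)` at `w`. -/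
def IsRegularAt (F : J2 → ℝ) (w : J2) : Prop :=
  (partialDeriv F 5 w, partialDeriv F 6 w, partialDeriv F 7 w) ≠ (0, 0, 0)

/-- `F = 0` on the open set `Ω` of `J2` is a smooth regular second order equation all of whose
points are hyperbolic. -/
structure IsHyperbolicEquation (Ω : Set J2) (F : J2 → ℝ) : Prop where
  isOpen : IsOpen Ω
  smooth : ContDiffOn ℝ ∞ F Ω
  regular : ∀ w ∈ equation Ω F, IsRegularAt F w
  hyperbolic : ∀ w ∈ equation Ω F, discriminant F w < 0

/-- The tangent space `T_w R = ker dF_w` of the hypersurface `R = {F = 0}`. -/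
def tangentR (F : J2 → ℝ) (w : J2) : Submodule ℝ J2 := (fderiv ℝ F w).ker

/-- The differential system `D = {ϖ₀ = ϖ₁ = ϖ₂ = 0}` on `R`: the vectors tangent to `R` that are
annihilated by the three contact forms. -/
def distD (F : J2 → ℝ) (w : J2) : Submodule ℝ J2 :=
  tangentR F w ⊓ ⨅ i : Fin 3, (contactCovector i w).ker

/-- The Grassmann bundle `J(D, 2)` over `R`, as a set of pairs `(w, v)`, where `w ∈ R` and `v` is a
two-dimensional subspace of `D(w)`. It is a subset of `J2 × Plane`, the Grassmann bundle
of all planes tangent to `J2`. -/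
def grassmannBundle (Ω : Set J2) (F : J2 → ℝ) : Set (J2 × Plane) :=
  {u | u.1 ∈ equation Ω F ∧ u.2.1 ≤ distD F u.1}

/-- `v` is an integral element of `D` at `w`: it is contained in `T_w R`, and the contact forms and
their exterior derivatives vanish on `v`. (The exterior derivative commutes with the restriction
of forms to `R`, so it may be computed on `J2`.) -/
def IsIntegralElement (F : J2 → ℝ) (w : J2) (v : Submodule ℝ J2) : Prop :=
  v ≤ tangentR F w ∧ ∀ i : Fin 3,
    (∀ a ∈ v, contactForm i w ![a] = 0) ∧
    ∀ a ∈ v, ∀ b ∈ v, extDeriv (contactForm i) w ![a, b] = 0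

/-- The rank two prolongation `Σ(R)`: the set of all two-dimensional integral elements. -/
def prolongation (Ω : Set J2) (F : J2 → ℝ) : Set (J2 × Plane) :=
  {u | u.1 ∈ equation Ω F ∧ IsIntegralElement F u.1 u.2.1}

theorem prolongation_subset (Ω : Set J2) (F : J2 → ℝ) :
    prolongation Ω F ⊆ grassmannBundle Ω F := by
  rintro u ⟨hu, ht, hi⟩
  refine ⟨hu, le_inf ht (le_iInf fun i a ha => ?_)⟩
  simpa [contactForm] using (hi i).1 a ha

/-- The projection `p : Σ(R) → R`. -/
def prolongationProj (Ω : Set J2) (F : J2 → ℝ) (u : prolongation Ω F) : equation Ω F :=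
  ⟨u.1.1, u.2.1⟩

/-! ### Smooth fibre bundles -/

/-- `p : Z → B` is a smooth fibre bundle with typical fibre `X`: around every point of `B` there
is a local trivialization `p⁻¹(U) ≃ U × X` over `U` which is smooth together with its inverse. -/
def IsSmoothFiberBundle
    {EZ HZ Z EB HB B EX HX : Type*}
    [NormedAddCommGroup EZ] [NormedSpace ℝ EZ] [TopologicalSpace HZ]
    (IZ : ModelWithCorners ℝ EZ HZ) [TopologicalSpace Z] [ChartedSpace HZ Z]
    [NormedAddCommGroup EB] [NormedSpace ℝ EB] [TopologicalSpace HB]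
    (IB : ModelWithCorners ℝ EB HB) [TopologicalSpace B] [ChartedSpace HB B]
    [NormedAddCommGroup EX] [NormedSpace ℝ EX] [TopologicalSpace HX]
    (IX : ModelWithCorners ℝ EX HX) (X : Type*) [TopologicalSpace X] [ChartedSpace HX X]
    (p : Z → B) : Prop :=
  ∀ b : B, ∃ e : Bundle.Trivialization X p, b ∈ e.baseSet ∧
    ContMDiffOn IZ (IB.prod IX) ∞ e e.source ∧
    ContMDiffOn (IB.prod IX) IZ ∞ e.toOpenPartialHomeomorph.symm e.target

end

end JetPDE

open JetPDE

/-!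
Write `a, b, r, s, t` for the differentials `dx, dy, dr, ds, dt`, and `A, B, C` for the derivatives
`F_r, F_s, F_t`. On `D` the form `dϖ₀` vanishes, and a plane in `D` is an integral element if and only
if the forms `ω₁ = a ∧ r + b ∧ s` and `ω₂ = a ∧ s + b ∧ t` vanish on it. In the pencil spanned by `ω₁`
and `ω₂` on the four-dimensional space `D` the degenerate forms are given by a quadratic equation
with discriminant `B² - 4 A C`. In the hyperbolic case there are two of them, and they are
`k ω₁ + C ω₂` and `A ω₁ + k ω₂`, for a nonzero root `k` of `k² - B k + A C = 0`. Up to the factor `k`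
they are decomposable, `α₁ ∧ α₂` and `β₁ ∧ β₂`, where

* `α₁ = k a - A b`, `α₂ = k r + C s + G b`,
* `β₁ = k b - C a`, `β₂ = A s + k t + H a`,

and `G`, `H` are the derivatives of `F` along the total derivatives in `x` and `y`. The root `k`
depends smoothly on the point, so that `ζ₁ = α₁ + i α₂` and `ζ₂ = β₁ + i β₂`, together with `dF` and
the contact forms, are a smooth field of linear coordinates of the jet space
(`AdaptedCoframe`, `exists_adaptedCoframe`). They identify `D` with `ℂ × ℂ`, and the integral
elements are exactly the products `l₁ × l₂` of a real line in the first factor and a real line in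
the second.

Submanifolds are handled by slice charts (`SliceChart`). Coordinates of `J2` whose last one is `F`
make the equation a slice. The pair `(w, v)` has as coordinates those of `w` and the matrix of
`v` as a graph with respect to linear coordinates that vary with `w`
(`LinearCoords.exists_bundleChart`). If these linear coordinates come from an adapted coframe,
`J(D, 2)` is a slice, and if they are moreover compatible with the splitting `ℂ × ℂ`, then the
prolongation is the slice on which the off-diagonal coefficients of the matrix vanish
(`exists_sliceChart_grassmannBundle`).

The bundle is trivialized by labelling a real line in `ℂ` by the point `z = ζ² / |ζ|²` of the circle,
where `ζ` is any nonzero vector of the line (`OnLine`). The label is visibly smooth in the line; in the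
other direction, for a vector `h` on the line labelled by `z₀`, the vector `h + z h̄` lies on the line
labelled by `z` and does not vanish for `z` near `z₀`, which gives the smoothness of the inverse
(`isSmoothFiberBundle_prolongationProj`).
-/

namespace JetPDE

/-! ### Slice charts and submanifolds -/

section Slice

variable {E₀ : Type*} [NormedAddCommGroup E₀] [NormedSpace ℝ E₀]
  {H₀ : Type*} [TopologicalSpace H₀] {I₀ : ModelWithCorners ℝ E₀ H₀}
  {M : Type*} [TopologicalSpace M] [ChartedSpace H₀ M]
  {E : Type*} [NormedAddCommGroup E] [NormedSpace ℝ E]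
  {F : Type*} [NormedAddCommGroup F] [NormedSpace ℝ F]

variable (I₀ E F) in
/-- A slice chart of a subset `S` of a manifold `M`: a partial diffeomorphism from `M` to `E × F`
in which `S` is the slice `E × {0}`. -/
structure SliceChart (S : Set M) extends OpenPartialHomeomorph M (E × F) where
  smooth : ContMDiffOn I₀ 𝓘(ℝ, E × F) ∞ toOpenPartialHomeomorph source
  smooth_symm : ContMDiffOn 𝓘(ℝ, E × F) I₀ ∞ toOpenPartialHomeomorph.symm target
  mem_iff : ∀ x ∈ source, x ∈ S ↔ (toOpenPartialHomeomorph x).2 = 0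

namespace SliceChart

variable {S : Set M}

open Classical in
/-- The chart of `S` with values in `E` induced by a slice chart. The base point `x₀` only provides
a junk value. -/
noncomputable def chart (Φ : SliceChart I₀ E F S) (x₀ : S) : OpenPartialHomeomorph S E where
  toFun x := (Φ.toOpenPartialHomeomorph x).1
  invFun y := if h : Φ.toOpenPartialHomeomorph.symm (y, 0) ∈ S then ⟨_, h⟩ else x₀
  source := Subtype.val ⁻¹' Φ.source
  target := (fun y => (y, (0 : F))) ⁻¹' Φ.target
  map_source' x hx := by
    have h : ((Φ.toOpenPartialHomeomorph x).1, (0 : F)) = Φ.toOpenPartialHomeomorph x :=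
      Prod.ext rfl ((Φ.mem_iff _ hx).1 x.2).symm
    simpa only [Set.mem_preimage, h] using Φ.map_source hx
  map_target' y hy := by
    have h : Φ.toOpenPartialHomeomorph.symm (y, 0) ∈ S := by
      rw [Φ.mem_iff _ (Φ.map_target hy), Φ.right_inv hy]
    simpa only [Set.mem_preimage, h, dif_pos] using Φ.map_target hy
  left_inv' x hx := by
    have h : ((Φ.toOpenPartialHomeomorph x).1, (0 : F)) = Φ.toOpenPartialHomeomorph x :=
      Prod.ext rfl ((Φ.mem_iff _ hx).1 x.2).symm
    have h' : Φ.toOpenPartialHomeomorph.symm ((Φ.toOpenPartialHomeomorph x).1, (0 : F)) = x := by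
      rw [h, Φ.left_inv hx]
    apply Subtype.ext
    simp only [h', Subtype.coe_prop, dif_pos]
  right_inv' y hy := by
    have h : Φ.toOpenPartialHomeomorph.symm (y, 0) ∈ S := by
      rw [Φ.mem_iff _ (Φ.map_target hy), Φ.right_inv hy]
    simp only [h, dif_pos, Φ.right_inv hy]
  open_source := Φ.open_source.preimage continuous_subtype_val
  open_target := Φ.open_target.preimage (by fun_prop)
  continuousOn_toFun := continuous_fst.comp_continuousOn
    (Φ.continuousOn_toFun.comp continuous_subtype_val.continuousOn fun _ h => h)
  continuousOn_invFun := by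
    rw [Topology.IsEmbedding.subtypeVal.continuousOn_iff]
    refine (Φ.continuousOn_invFun.comp (f := fun y => (y, (0 : F))) (by fun_prop)
      fun _ h => h).congr fun y hy => ?_
    have h : Φ.toOpenPartialHomeomorph.symm (y, 0) ∈ S := by
      rw [Φ.mem_iff _ (Φ.map_target hy), Φ.right_inv hy]
    simp only [Function.comp, h, dif_pos]
    rfl

theorem coe_chart_symm (Φ : SliceChart I₀ E F S) (x₀ : S) {y : E}
    (hy : y ∈ (Φ.chart x₀).target) :
    ((Φ.chart x₀).symm y : M) = Φ.toOpenPartialHomeomorph.symm (y, 0) := by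
  have h : Φ.toOpenPartialHomeomorph.symm (y, 0) ∈ S := by
    rw [Φ.mem_iff _ (Φ.map_target hy), Φ.right_inv hy]
  classical
  change ((dite _ _ _ : S) : M) = _
  rw [dif_pos h]

theorem apply_chart_symm (Φ : SliceChart I₀ E F S) (x₀ : S) {y : E}
    (hy : y ∈ (Φ.chart x₀).target) :
    Φ.toOpenPartialHomeomorph ((Φ.chart x₀).symm y : M) = (y, 0) := by
  rw [coe_chart_symm Φ x₀ hy]
  exact Φ.right_inv hy

theorem contDiffOn_transition (Φ Φ' : SliceChart I₀ E F S) (x₀ x₁ : S) :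
    ContDiffOn ℝ ∞ ((Φ.chart x₀).symm ≫ₕ Φ'.chart x₁)
      ((Φ.chart x₀).symm ≫ₕ Φ'.chart x₁).source := by
  have h1 : ContMDiffOn 𝓘(ℝ, E) 𝓘(ℝ, E × F) ∞ (fun y : E => (y, (0 : F)))
      ((Φ.chart x₀).symm ≫ₕ Φ'.chart x₁).source := by
    rw [contMDiffOn_iff_contDiffOn]
    fun_prop
  have h2 := Φ.smooth_symm.comp h1 fun y hy => hy.1
  have h3 := Φ'.smooth.comp h2 fun y hy => by
    have := hy.2
    simp only [Set.mem_preimage] at this ⊢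
    rw [Function.comp_apply, ← coe_chart_symm Φ x₀ hy.1]
    exact this
  rw [contMDiffOn_iff_contDiffOn] at h3
  refine (contDiff_fst.comp_contDiffOn h3).congr fun y hy => ?_
  change (Φ'.toOpenPartialHomeomorph ((Φ.chart x₀).symm y : M)).1 = _
  rw [coe_chart_symm Φ x₀ hy.1]
  rfl

theorem transition_mem_contDiffGroupoid (Φ Φ' : SliceChart I₀ E F S) (x₀ x₁ : S) :
    (Φ.chart x₀).symm ≫ₕ Φ'.chart x₁ ∈ contDiffGroupoid ∞ 𝓘(ℝ, E) := by
  have key := contDiffOn_transition (Φ := Φ) (Φ' := Φ') x₀ x₁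
  have key' := contDiffOn_transition (Φ := Φ') (Φ' := Φ) x₁ x₀
  rw [contDiffGroupoid, mem_groupoid_of_pregroupoid]
  constructor
  · simpa [contDiffPregroupoid] using key
  · simpa [contDiffPregroupoid] using key'

end SliceChart

/-- A set with a slice chart at every point is a manifold, and all its slice charts are charts of
the maximal atlas. -/
theorem exists_chartedSpace_of_sliceChart {S : Set M}
    (h : ∀ x ∈ S, ∃ Φ : SliceChart I₀ E F S, x ∈ Φ.source) :
    ∃ _ : ChartedSpace E S, IsManifold 𝓘(ℝ, E) ∞ S ∧
      ∀ (Φ : SliceChart I₀ E F S) (x₀ : S),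
        Φ.chart x₀ ∈ IsManifold.maximalAtlas 𝓘(ℝ, E) ∞ S := by
  choose Φ hΦ using h
  let c : ChartedSpace E S :=
    { atlas := Set.range fun x : S => (Φ x x.2).chart x
      chartAt := fun x => (Φ x x.2).chart x
      mem_chart_source := fun x => hΦ x x.2
      chart_mem_atlas := fun x => Set.mem_range_self x }
  refine ⟨c, ?_, ?_⟩
  · refine @IsManifold.mk' _ _ _ _ _ _ _ _ _ _ _ c ⟨?_⟩
    rintro _ _ ⟨x, rfl⟩ ⟨y, rfl⟩
    exact SliceChart.transition_mem_contDiffGroupoid _ _ _ _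
  · intro Ψ x₀
    rw [IsManifold.mem_maximalAtlas_iff, mem_maximalAtlas_iff]
    rintro _ ⟨x, rfl⟩
    exact ⟨SliceChart.transition_mem_contDiffGroupoid _ _ _ _,
      SliceChart.transition_mem_contDiffGroupoid _ _ _ _⟩

theorem isSmoothEmbedding_subtypeVal {S : Set M} [IsManifold I₀ ∞ M] [I₀.Boundaryless]
    [ChartedSpace E S] (c : (E × F) ≃L[ℝ] E₀)
    (h : ∀ x ∈ S, ∃ Φ : SliceChart I₀ E F S, x ∈ Φ.source)
    (hS : ∀ (Φ : SliceChart I₀ E F S) (x₀ : S),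
        Φ.chart x₀ ∈ IsManifold.maximalAtlas 𝓘(ℝ, E) ∞ S) :
    IsSmoothEmbedding 𝓘(ℝ, E) I₀ ∞ (Subtype.val : S → M) := by
  refine ⟨IsImmersionOfComplement.isImmersion (F := F) fun x => ?_, .subtypeVal⟩
  obtain ⟨Φ, hx⟩ := h x x.2
  let e : (E × F) ≃ₜ H₀ := c.toHomeomorph.trans I₀.toHomeomorph.symm
  have he : ContMDiff 𝓘(ℝ, E × F) I₀ ∞ e := by
    have := I₀.contMDiffOn_symm (n := ∞)
    rw [I₀.range_eq_univ, contMDiffOn_univ] at this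
    exact this.comp c.contDiff.contMDiff
  have he' : ContMDiff I₀ 𝓘(ℝ, E × F) ∞ e.symm :=
    c.symm.contDiff.contMDiff.comp I₀.contMDiff
  refine .mk_of_charts c (Φ.chart x) (Φ.toOpenPartialHomeomorph.transHomeomorph e) hx hx
    (hS Φ x) ?_ (fun _ h => h) ?_
  · exact OpenPartialHomeomorph.mem_maximalAtlas_of_contMDiffOn _
      (he.comp_contMDiffOn Φ.smooth) (Φ.smooth_symm.comp he'.contMDiffOn fun _ h => h)
  · intro y hy
    have hy' : y ∈ (Φ.chart x).target := by simpa using hy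
    have h1 := Φ.apply_chart_symm x hy'
    change I₀ (I₀.symm (c (Φ.toOpenPartialHomeomorph ((Φ.chart x).symm y : M)))) = c (y, 0)
    rw [h1, I₀.right_inv (I₀.range_eq_univ ▸ Set.mem_univ _)]

/-- A linear change of coordinates turns a slice chart of `S` into one of `S'`, where `S'` is any set
that is a slice in the new coordinates. -/
def SliceChart.congr {S : Set M} {E' F' : Type*} [NormedAddCommGroup E'] [NormedSpace ℝ E']
    [NormedAddCommGroup F'] [NormedSpace ℝ F'] (Φ : SliceChart I₀ E F S) (S' : Set M)
    (c : (E × F) ≃L[ℝ] (E' × F'))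
    (hc : ∀ x ∈ Φ.source, x ∈ S' ↔ (c (Φ.toOpenPartialHomeomorph x)).2 = 0) :
    SliceChart I₀ E' F' S' where
  toOpenPartialHomeomorph := Φ.toOpenPartialHomeomorph.transHomeomorph c.toHomeomorph
  smooth := (c.contDiff.contMDiff.comp_contMDiffOn Φ.smooth)
  smooth_symm := Φ.smooth_symm.comp c.symm.contDiff.contMDiff.contMDiffOn fun _ h => h
  mem_iff := hc

/-- If `S ⊆ S'` and near every point of `S` there are coordinates of the ambient manifold in which
both sets are slices, then `S` is an embedded submanifold of `S'`. -/
theorem isSmoothEmbedding_inclusion {S S' : Set M} (hSS' : S ⊆ S')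
    {E' F' : Type*} [NormedAddCommGroup E'] [NormedSpace ℝ E']
    [NormedAddCommGroup F'] [NormedSpace ℝ F']
    [ChartedSpace E S] [ChartedSpace E' S'] [IsManifold 𝓘(ℝ, E') ∞ S']
    (h : ∀ x ∈ S, ∃ Φ : SliceChart I₀ (E × F) F' S', x ∈ Φ.source ∧
      ∀ y ∈ Φ.source, y ∈ S ↔ (Φ.toOpenPartialHomeomorph y).1.2 = 0 ∧
        (Φ.toOpenPartialHomeomorph y).2 = 0)
    (hS : ∀ (Φ : SliceChart I₀ E (F × F') S) (x₀ : S),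
        Φ.chart x₀ ∈ IsManifold.maximalAtlas 𝓘(ℝ, E) ∞ S)
    (c : (E × F) ≃L[ℝ] E') (hS' : ∀ (Φ : SliceChart I₀ E' F' S') (x₀ : S'),
        Φ.chart x₀ ∈ IsManifold.maximalAtlas 𝓘(ℝ, E') ∞ S') :
    IsSmoothEmbedding 𝓘(ℝ, E) 𝓘(ℝ, E') ∞ (Set.inclusion hSS') := by
  refine ⟨IsImmersionOfComplement.isImmersion (F := F) fun x => ?_, .inclusion hSS'⟩
  obtain ⟨Φ, hx, hΦ⟩ := h x x.2
  let Φ₁ : SliceChart I₀ E (F × F') S :=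
    Φ.congr S (ContinuousLinearEquiv.prodAssoc ℝ E F F') fun y hy => by
      rw [hΦ y hy]; simp [Prod.ext_iff]
  let Φ₂ : SliceChart I₀ E' F' S' :=
    Φ.congr S' (c.prodCongr (.refl ℝ F')) fun y hy => by
      rw [Φ.mem_iff y hy]; simp
  refine .mk_of_charts c (Φ₁.chart x) (Φ₂.chart (Set.inclusion hSS' x)) hx hx
    (hS _ _) (hS' _ _) (fun _ h => h) ?_
  intro y hy
  have hy' : y ∈ (Φ₁.chart x).target := by simpa using hy
  have h1 := Φ₁.apply_chart_symm x hy'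
  change c (Φ.toOpenPartialHomeomorph ((Φ₁.chart x).symm y : M)).1 = c (y, 0)
  have h2 : (Φ.toOpenPartialHomeomorph ((Φ₁.chart x).symm y : M)).1 = (y, 0) := by
    have h3 : ContinuousLinearEquiv.prodAssoc ℝ E F F'
      (Φ.toOpenPartialHomeomorph ((Φ₁.chart x).symm y : M)) = (y, 0) := h1
    simp only [Prod.ext_iff, Prod.fst_zero, Prod.snd_zero] at h3
    exact Prod.ext h3.1 h3.2.1
  rw [h2]

end Slice

/-! ### Smooth maps to and from the Grassmann manifold -/

/-- Inhomogeneous Grassmann coordinates as an open partial homeomorphism. -/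
noncomputable def planeHomeo (e : J2 ≃L[ℝ] E2 × E6) : OpenPartialHomeomorph Plane (E2 →L[ℝ] E6) :=
  planeCore.openPartialHomeomorph (planeChart e) ⟨e, rfl⟩

theorem planeHomeo_mem_maximalAtlas (e : J2 ≃L[ℝ] E2 × E6) :
    planeHomeo e ∈ IsManifold.maximalAtlas 𝓘(ℝ, E2 →L[ℝ] E6) ∞ Plane := by
  apply IsManifold.subset_maximalAtlas
  change _ ∈ ⋃ (e : PartialEquiv Plane (E2 →L[ℝ] E6)) (he : e ∈ planeCore.atlas),
    {planeCore.openPartialHomeomorph e he}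
  simp only [Set.mem_iUnion, Set.mem_singleton_iff]
  exact ⟨planeChart e, ⟨e, rfl⟩, rfl⟩

theorem coe_eq_planeGraph {e : J2 ≃L[ℝ] E2 × E6} {v : Plane} (hv : v ∈ (planeHomeo e).source) :
    v.1 = planeGraph e (planeHomeo e v) := by
  obtain ⟨T, hT⟩ := hv
  have h : planeHomeo e v = T := planeChart_apply hT
  rw [h, hT]

theorem injective_of_range_eq {v : Plane} {B : E2 →L[ℝ] J2} (h : v.1 = B.range) :
    Function.Injective B := by
  have h1 : Module.finrank ℝ B.range = 2 := by rw [← h]; exact v.2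
  have h2 := LinearMap.finrank_range_add_finrank_ker B.toLinearMap
  have h3 : Module.finrank ℝ B.range = Module.finrank ℝ (LinearMap.range B.toLinearMap) := rfl
  rw [← h3, h1] at h2
  simp only [finrank_euclideanSpace, Fintype.card_fin] at h2
  exact LinearMap.ker_eq_bot.1 (Submodule.finrank_eq_zero.1 (by omega))

theorem isUnit_of_injective {A : E2 →L[ℝ] E2} (h : Function.Injective A) : IsUnit A := by
  let f : E2 ≃ₗ[ℝ] E2 := LinearEquiv.ofInjectiveEndo A.toLinearMap h
  refine ⟨(ContinuousLinearEquiv.unitsEquiv ℝ E2).symm f.toContinuousLinearEquiv, ?_⟩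
  ext1 x
  rfl

section

variable {E₀ : Type*} [NormedAddCommGroup E₀] [NormedSpace ℝ E₀]
  {H₀ : Type*} [TopologicalSpace H₀] {I₀ : ModelWithCorners ℝ E₀ H₀}
  {N : Type*} [TopologicalSpace N] [ChartedSpace H₀ N]

theorem contMDiffAt_ringInverse_comp {A : N → (E2 →L[ℝ] E2)} {n : N}
    (hA : ContMDiffAt I₀ 𝓘(ℝ, E2 →L[ℝ] E2) ∞ A n) (h : IsUnit (A n)) :
    ContMDiffAt I₀ 𝓘(ℝ, E2 →L[ℝ] E2) ∞ (fun m => Ring.inverse (A m)) n := by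
  obtain ⟨u, hu⟩ := h
  have h1 := contDiffAt_ringInverse ℝ u (n := ∞)
  rw [hu] at h1
  exact h1.contMDiffAt.comp n hA

/-- A plane depends smoothly on parameters as soon as it is the range of a linear map that depends
smoothly on them. -/
theorem contMDiffAt_plane_of_range {V : N → Plane} {B : N → (E2 →L[ℝ] J2)} {n : N}
    (hB : ContMDiffAt I₀ 𝓘(ℝ, E2 →L[ℝ] J2) ∞ B n) (h : ∀ᶠ m in nhds n, (V m).1 = (B m).range) :
    ContMDiffAt I₀ 𝓘(ℝ, E2 →L[ℝ] E6) ∞ V n := by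
  obtain ⟨e, T₀, hT₀⟩ := exists_planeChart (V n)
  let p : J2 →L[ℝ] E2 := ContinuousLinearMap.fst ℝ E2 E6 ∘L (e : J2 →L[ℝ] E2 × E6)
  let q : J2 →L[ℝ] E6 := ContinuousLinearMap.snd ℝ E2 E6 ∘L (e : J2 →L[ℝ] E2 × E6)
  have hA : ContMDiffAt I₀ 𝓘(ℝ, E2 →L[ℝ] E2) ∞ (fun m => p ∘L B m) n :=
    contMDiffAt_const.clm_comp hB
  have hu : IsUnit (p ∘L B n) := by
    apply isUnit_of_injective
    rw [injective_iff_map_eq_zero]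
    intro x hx
    have h1 : B n x ∈ planeGraph e T₀ := by
      rw [← hT₀, h.self_of_nhds]; exact ⟨x, rfl⟩
    have hx' : (e (B n x)).1 = 0 := hx
    rw [mem_planeGraph, hx', map_zero] at h1
    have h2 : e (B n x) = 0 := Prod.ext hx' h1
    have h3 : B n x = 0 := by simpa using h2
    exact (injective_iff_map_eq_zero _).1 (injective_of_range_eq h.self_of_nhds) x h3
  have hT := (contMDiffAt_const (c := q)).clm_comp hB |>.clm_comp
    (contMDiffAt_ringInverse_comp hA hu)
  have hev : ∀ᶠ m in nhds n, V m = (planeHomeo e).symm ((q ∘L B m) ∘L Ring.inverse (p ∘L B m)) := by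
    filter_upwards [h, hA.continuousAt.eventually (Units.isOpen.mem_nhds hu)] with m hm hum
    apply Subtype.ext
    change _ = planeGraph e _
    rw [hm]
    apply Submodule.eq_of_le_of_finrank_eq
    · rintro _ ⟨x, rfl⟩
      rw [mem_planeGraph]
      have h1 : Ring.inverse (p ∘L B m) ((p ∘L B m) x) = x :=
        DFunLike.congr_fun (Ring.inverse_mul_cancel _ hum) x
      change q (B m x) = q (B m (Ring.inverse (p ∘L B m) ((p ∘L B m) x)))
      rw [h1]
    · rw [← hm, (V m).2, finrank_planeGraph]
  refine ContMDiffAt.congr_of_eventuallyEq ?_ hev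
  exact (contMDiffAt_symm_of_mem_maximalAtlas (planeHomeo_mem_maximalAtlas e) (Set.mem_univ _)).comp
    n hT

end

/-- Near a given plane, a basis of a plane can be chosen smoothly. -/
theorem exists_smooth_frame (v₀ : Plane) : ∃ B : Plane → (E2 →L[ℝ] J2),
    ContMDiffAt 𝓘(ℝ, E2 →L[ℝ] E6) 𝓘(ℝ, E2 →L[ℝ] J2) ∞ B v₀ ∧
      ∀ᶠ v in nhds v₀, v.1 = (B v).range := by
  obtain ⟨e, he⟩ := exists_planeChart v₀
  have he' : v₀ ∈ (planeHomeo e).source := he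
  refine ⟨fun v => (e.symm : E2 × E6 →L[ℝ] J2) ∘L (ContinuousLinearMap.inl ℝ E2 E6 +
    ContinuousLinearMap.inr ℝ E2 E6 ∘L planeHomeo e v), ?_, ?_⟩
  · have h1 := contMDiffAt_of_mem_maximalAtlas (planeHomeo_mem_maximalAtlas e) he'
    have h2 : ContDiff ℝ ∞ fun T : E2 →L[ℝ] E6 => (e.symm : E2 × E6 →L[ℝ] J2) ∘L
        (ContinuousLinearMap.inl ℝ E2 E6 + ContinuousLinearMap.inr ℝ E2 E6 ∘L T) :=
      contDiff_const.clm_comp (contDiff_const.add (contDiff_const.clm_comp contDiff_id))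
    exact h2.contMDiff.contMDiffAt.comp v₀ h1
  · filter_upwards [(planeHomeo e).open_source.mem_nhds he'] with v hv
    rw [coe_eq_planeGraph hv]
    ext x
    have key : ∀ y : E2, ((e.symm : E2 × E6 →L[ℝ] J2) ∘L (ContinuousLinearMap.inl ℝ E2 E6 +
        ContinuousLinearMap.inr ℝ E2 E6 ∘L planeHomeo e v)) y = e.symm (y, planeHomeo e v y) := by
      intro y; simp [← map_add]
    constructor
    · intro hx
      refine ⟨(e x).1, ?_⟩
      rw [mem_planeGraph] at hx
      refine (key _).trans ?_
      rw [← hx]; simp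
    · rintro ⟨y, rfl⟩
      have := symm_mem_planeGraph e (planeHomeo e v) y
      rwa [← key y] at this

/-! ### The integrability condition in coordinates -/

theorem contactCovector_apply_zero (w x : J2) :
    contactCovector 0 w x = x 2 - w 3 * x 0 - w 4 * x 1 := by
  simp [contactCovector, dcoord]

theorem contactCovector_apply_one (w x : J2) :
    contactCovector 1 w x = x 3 - w 5 * x 0 - w 6 * x 1 := by
  simp [contactCovector, dcoord]

theorem contactCovector_apply_two (w x : J2) :
    contactCovector 2 w x = x 4 - w 6 * x 0 - w 7 * x 1 := by
  simp [contactCovector, dcoord]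

theorem contDiff_contactCovector (i : Fin 3) : ContDiff ℝ ∞ (contactCovector i) := by
  rw [contDiff_clm_apply_iff]
  intro y
  fin_cases i
  · simp only [Fin.zero_eta, contactCovector_apply_zero]; fun_prop
  · simp only [Fin.mk_one, contactCovector_apply_one]; fun_prop
  · simp only [Fin.reduceFinMk, contactCovector_apply_two]; fun_prop

theorem fderiv_contact (j k l : Fin 8) (m n : Fin 8) (w a b : J2) :
    fderiv ℝ (fun w : J2 => b j - w k * b m - w l * b n) w a = - a k * b m - a l * b n := by
  have h : HasFDerivAt (fun w : J2 => b j - w k * b m - w l * b n)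
      (0 - b m • dcoord k - b n • dcoord l) w :=
    ((hasFDerivAt_const (b j) w).sub ((dcoord k).hasFDerivAt.mul_const _)).sub
      ((dcoord l).hasFDerivAt.mul_const _)
  rw [h.fderiv]
  simp [dcoord, mul_comm]

theorem extDeriv_contactForm (i : Fin 3) (w a b : J2) :
    extDeriv (contactForm i) w ![a, b] =
      fderiv ℝ (fun w => contactCovector i w b) w a
        - fderiv ℝ (fun w => contactCovector i w a) w b := by
  have hd : DifferentiableAt ℝ (contactForm i) w :=
    ((ContinuousAlternatingMap.ofSubsingletonLIE (𝕜 := ℝ) (E := J2) (F := ℝ) (0 : Fin 1)).contDiff.comp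
      (contDiff_contactCovector i)).differentiable (by simp) w
  rw [extDeriv_apply hd]
  simp only [contactForm, ContinuousAlternatingMap.ofSubsingleton_apply_apply]
  simp [Fin.removeNth, sub_eq_add_neg]

theorem extDeriv_contactForm_zero (w a b : J2) : extDeriv (contactForm 0) w ![a, b] =
    (a 0 * b 3 - b 0 * a 3) + (a 1 * b 4 - b 1 * a 4) := by
  simp only [extDeriv_contactForm, contactCovector_apply_zero, fderiv_contact]
  ring

theorem extDeriv_contactForm_one (w a b : J2) : extDeriv (contactForm 1) w ![a, b] =
    (a 0 * b 5 - b 0 * a 5) + (a 1 * b 6 - b 1 * a 6) := by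
  simp only [extDeriv_contactForm, contactCovector_apply_one, fderiv_contact]
  ring

theorem extDeriv_contactForm_two (w a b : J2) : extDeriv (contactForm 2) w ![a, b] =
    (a 0 * b 6 - b 0 * a 6) + (a 1 * b 7 - b 1 * a 7) := by
  simp only [extDeriv_contactForm, contactCovector_apply_two, fderiv_contact]
  ring

theorem mem_distD_iff {F : J2 → ℝ} {w x : J2} :
    x ∈ distD F w ↔ fderiv ℝ F w x = 0 ∧ ∀ i, contactCovector i w x = 0 := by
  simp [distD, tangentR]

/-- On `D` the form `dϖ₀` vanishes identically, so that integral elements are given by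
`dϖ₁` and `dϖ₂` alone. -/
theorem isIntegralElement_iff {F : J2 → ℝ} {w : J2} {v : Submodule ℝ J2} :
    IsIntegralElement F w v ↔ v ≤ distD F w ∧ ∀ a ∈ v, ∀ b ∈ v,
      (a 0 * b 5 - b 0 * a 5) + (a 1 * b 6 - b 1 * a 6) = 0 ∧
      (a 0 * b 6 - b 0 * a 6) + (a 1 * b 7 - b 1 * a 7) = 0 := by
  constructor
  · rintro ⟨ht, hi⟩
    refine ⟨fun a ha => mem_distD_iff.2 ⟨ht ha, fun i => ?_⟩, fun a ha b hb => ⟨?_, ?_⟩⟩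
    · simpa [contactForm] using (hi i).1 a ha
    · rw [← extDeriv_contactForm_one w]; exact (hi 1).2 a ha b hb
    · rw [← extDeriv_contactForm_two w]; exact (hi 2).2 a ha b hb
  · rintro ⟨hv, hi⟩
    have hc : ∀ a ∈ v, ∀ i, contactCovector i w a = 0 := fun a ha => (mem_distD_iff.1 (hv ha)).2
    refine ⟨fun a ha => (mem_distD_iff.1 (hv ha)).1, fun i => ⟨fun a ha => ?_, fun a ha b hb => ?_⟩⟩
    · simpa [contactForm] using hc a ha i
    · fin_cases i
      · have a1 := hc a ha 1
        have a2 := hc a ha 2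
        have b1 := hc b hb 1
        have b2 := hc b hb 2
        rw [contactCovector_apply_one] at a1 b1
        rw [contactCovector_apply_two] at a2 b2
        simp only [Fin.zero_eta, extDeriv_contactForm_zero]
        linear_combination a 0 * b1 - b 0 * a1 + a 1 * b2 - b 1 * a2
      · exact (extDeriv_contactForm_one w a b).trans (hi a ha b hb).1
      · exact (extDeriv_contactForm_two w a b).trans (hi a ha b hb).2

theorem fderiv_eq_sum_partialDeriv (F : J2 → ℝ) (w x : J2) :
    fderiv ℝ F w x = ∑ i, x i * partialDeriv F i w := by
  conv_lhs => rw [← (EuclideanSpace.basisFun (Fin 8) ℝ).sum_repr x]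
  simp [partialDeriv]

/-! ### The adapted coframe of a hyperbolic equation -/

/-- The values of an adapted coframe: the two complex coordinates are the two pairs of
characteristic covectors, the remaining four real ones cut out the distribution `D`. -/
abbrev Cof : Type := (ℂ × ℂ) × (ℝ × (Fin 3 → ℝ))

/-- A smooth field of linear coordinates `L w = ((ζ₁, ζ₂), η)` on `J2`, over an open set `W`, such
that `D = {η = 0}` and such that the integral elements of `D` are the planes on which both
`Re ζ₁ ∧ Im ζ₁` and `Re ζ₂ ∧ Im ζ₂` vanish. -/
structure AdaptedCoframe (F : J2 → ℝ) (W : Set J2) where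
  coframe : J2 → (J2 →L[ℝ] Cof)
  frame : J2 → (Cof →L[ℝ] J2)
  contDiffOn_coframe : ContDiffOn ℝ ∞ coframe W
  contDiffOn_frame : ContDiffOn ℝ ∞ frame W
  frame_coframe : ∀ w ∈ W, ∀ x, frame w (coframe w x) = x
  coframe_frame : ∀ w ∈ W, ∀ y, coframe w (frame w y) = y
  mem_distD_iff : ∀ w ∈ W, ∀ x, x ∈ distD F w ↔ (coframe w x).2 = 0
  isIntegralElement_iff : ∀ w ∈ W, ∀ v : Submodule ℝ J2, IsIntegralElement F w v ↔
    v ≤ distD F w ∧ ∀ a ∈ v, ∀ b ∈ v,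
      (coframe w a).1.1.re * (coframe w b).1.1.im
        - (coframe w b).1.1.re * (coframe w a).1.1.im = 0 ∧
      (coframe w a).1.2.re * (coframe w b).1.2.im
        - (coframe w b).1.2.re * (coframe w a).1.2.im = 0

/-- The characteristic covectors, for `A = F_r`, `C = F_t`, a root `k` of `k² - F_s k + A C`, and the
derivatives `G`, `H` of `F` along the total derivatives in `x` and `y`. -/
noncomputable def charCovector (k A C G H : ℝ) : J2 →L[ℝ] ℂ × ℂ :=
  ((Complex.equivRealProdCLM.symm : ℝ × ℝ →L[ℝ] ℂ) ∘L
    ((k • dcoord 0 - A • dcoord 1).prod (k • dcoord 5 + C • dcoord 6 + G • dcoord 1))).prod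
  ((Complex.equivRealProdCLM.symm : ℝ × ℝ →L[ℝ] ℂ) ∘L
    ((k • dcoord 1 - C • dcoord 0).prod (A • dcoord 6 + k • dcoord 7 + H • dcoord 0)))

theorem charCovector_apply (k A C G H : ℝ) (x : J2) : charCovector k A C G H x =
    (⟨k * x 0 - A * x 1, k * x 5 + C * x 6 + G * x 1⟩,
      ⟨k * x 1 - C * x 0, A * x 6 + k * x 7 + H * x 0⟩) := by
  have h (a b : ℝ) : Complex.equivRealProdCLM.symm (a, b) = ⟨a, b⟩ := by
    apply Complex.ext <;> simp
  simp only [charCovector, dcoord]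
  ext1 <;> simp [h]

theorem contDiffOn_charCovector {k A C G H : J2 → ℝ} {W : Set J2} (hk : ContDiffOn ℝ ∞ k W)
    (hA : ContDiffOn ℝ ∞ A W) (hC : ContDiffOn ℝ ∞ C W) (hG : ContDiffOn ℝ ∞ G W)
    (hH : ContDiffOn ℝ ∞ H W) :
    ContDiffOn ℝ ∞ (fun w => charCovector (k w) (A w) (C w) (G w) (H w)) W := by
  rw [contDiffOn_clm_apply]
  intro y
  simp only [charCovector_apply]
  have h {f g : J2 → ℝ} (hf : ContDiffOn ℝ ∞ f W) (hg : ContDiffOn ℝ ∞ g W) :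
      ContDiffOn ℝ ∞ (fun w => (⟨f w, g w⟩ : ℂ)) W :=
    Complex.equivRealProdCLM.symm.contDiff.comp_contDiffOn (hf.prodMk hg)
  exact (h (by fun_prop) (by fun_prop)).prodMk (h (by fun_prop) (by fun_prop))

/-- The derivatives of `F` along the vector fields `∂ₓ + p ∂_z + r ∂_p + s ∂_q` and
`∂_y + q ∂_z + s ∂_p + t ∂_q`. -/
noncomputable def totalDeriv (F : J2 → ℝ) (w : J2) : ℝ × ℝ :=
  (partialDeriv F 0 w + w 3 * partialDeriv F 2 w + w 5 * partialDeriv F 3 w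
    + w 6 * partialDeriv F 4 w,
  partialDeriv F 1 w + w 4 * partialDeriv F 2 w + w 6 * partialDeriv F 3 w
    + w 7 * partialDeriv F 4 w)

theorem finrank_Cof : Module.finrank ℝ Cof = 8 := by
  simp [Complex.finrank_real_complex]

theorem contDiffOn_partialDeriv {Ω : Set J2} {F : J2 → ℝ} (hΩ : IsOpen Ω)
    (hF : ContDiffOn ℝ ∞ F Ω) (i : Fin 8) : ContDiffOn ℝ ∞ (partialDeriv F i) Ω :=
  (hF.fderiv_of_isOpen hΩ (by simp)).clm_apply contDiffOn_const

/-- On `D` the differential of `F` only involves the total derivatives and the derivatives in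
`r`, `s`, `t`. -/
theorem fderiv_eq_of_contact {F : J2 → ℝ} {w x : J2} (h : ∀ i, contactCovector i w x = 0) :
    fderiv ℝ F w x = (totalDeriv F w).1 * x 0 + (totalDeriv F w).2 * x 1 +
      partialDeriv F 5 w * x 5 + partialDeriv F 6 w * x 6 + partialDeriv F 7 w * x 7 := by
  have h0 := h 0
  have h1 := h 1
  have h2 := h 2
  rw [contactCovector_apply_zero] at h0
  rw [contactCovector_apply_one] at h1
  rw [contactCovector_apply_two] at h2
  rw [fderiv_eq_sum_partialDeriv]
  simp only [Fin.sum_univ_eight, totalDeriv]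
  linear_combination partialDeriv F 2 w * h0 + partialDeriv F 3 w * h1 + partialDeriv F 4 w * h2

/-- A smooth root `k` of `k² - F_s k + F_r F_t` that is neither zero nor a double root provides an
adapted coframe: the two forms `k dϖ₁ + F_t dϖ₂` and `F_r dϖ₁ + k dϖ₂` are decomposable on `D`,
and the pairs of covectors into which they decompose are the characteristic covectors. -/
noncomputable def adaptedCoframeOfRoot {F : J2 → ℝ} {W : Set J2} (hW : IsOpen W)
    (hF : ContDiffOn ℝ ∞ F W) {k : J2 → ℝ} (hk : ContDiffOn ℝ ∞ k W)
    (hroot : ∀ w ∈ W, k w ^ 2 - partialDeriv F 6 w * k w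
      + partialDeriv F 5 w * partialDeriv F 7 w = 0)
    (hk0 : ∀ w ∈ W, k w ≠ 0)
    (hk1 : ∀ w ∈ W, k w ^ 2 - partialDeriv F 5 w * partialDeriv F 7 w ≠ 0) :
    AdaptedCoframe F W :=
  let L : J2 → (J2 →L[ℝ] Cof) := fun w =>
    (charCovector (k w) (partialDeriv F 5 w) (partialDeriv F 7 w) (totalDeriv F w).1
      (totalDeriv F w).2).prod
    ((fderiv ℝ F w).prod (ContinuousLinearMap.pi fun i => contactCovector i w))
  have hL : ∀ w x, L w x = (charCovector (k w) (partialDeriv F 5 w) (partialDeriv F 7 w)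
      (totalDeriv F w).1 (totalDeriv F w).2 x, fderiv ℝ F w x, fun i => contactCovector i w x) :=
    fun _ _ => rfl
  have hsm : ContDiffOn ℝ ∞ L W := by
    have hp := contDiffOn_partialDeriv hW hF
    have h1 : ContDiffOn ℝ ∞ (fun w => (totalDeriv F w).1) W := by
      simp only [totalDeriv]; fun_prop
    have h2 : ContDiffOn ℝ ∞ (fun w => (totalDeriv F w).2) W := by
      simp only [totalDeriv]; fun_prop
    have h3 := contDiffOn_charCovector hk (hp 5) (hp 7) h1 h2
    have h4 : ContDiffOn ℝ ∞ (fderiv ℝ F) W := hF.fderiv_of_isOpen hW (by simp)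
    rw [contDiffOn_clm_apply]
    intro y
    exact (h3.clm_apply contDiffOn_const).prodMk ((h4.clm_apply contDiffOn_const).prodMk
      (contDiffOn_pi.2 fun i => ((contDiff_contactCovector i).contDiffOn.clm_apply
        contDiffOn_const)))
  have hD : ∀ w x, x ∈ distD F w ↔ (L w x).2 = 0 := by
    intro w x
    rw [mem_distD_iff, hL, Prod.ext_iff, funext_iff]
    rfl
  have hinj : ∀ w ∈ W, Function.Injective (L w) := by
    intro w hw
    rw [injective_iff_map_eq_zero]
    intro x hx
    have hxD : x ∈ distD F w := by rw [hD, hx]; rfl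
    have hc := (mem_distD_iff.1 hxD).2
    have hf := (mem_distD_iff.1 hxD).1
    rw [fderiv_eq_of_contact hc] at hf
    have hc0 := hc 0
    have hc1 := hc 1
    have hc2 := hc 2
    rw [contactCovector_apply_zero] at hc0
    rw [contactCovector_apply_one] at hc1
    rw [contactCovector_apply_two] at hc2
    rw [hL, charCovector_apply] at hx
    simp only [Prod.ext_iff, Complex.ext_iff, Prod.fst_zero, Prod.snd_zero, Complex.zero_re,
      Complex.zero_im] at hx
    obtain ⟨⟨⟨e1, e2⟩, e3, e4⟩, -⟩ := hx
    have hk0 := hk0 w hw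
    have hk1 := hk1 w hw
    have hroot := hroot w hw
    generalize (totalDeriv F w).1 = G at *
    generalize (totalDeriv F w).2 = H at *
    generalize partialDeriv F 5 w = A at *
    generalize partialDeriv F 6 w = B at *
    generalize partialDeriv F 7 w = C at *
    generalize k w = k at *
    have x0 : x 0 = 0 := by
      apply (mul_eq_zero.1 _).resolve_left hk1
      linear_combination k * e1 + A * e3
    have x1 : x 1 = 0 := by
      apply (mul_eq_zero.1 _).resolve_left hk1
      linear_combination C * e1 + k * e3
    simp only [x0, x1] at hc0 hc1 hc2 hf e2 e4
    have x6 : x 6 = 0 := by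
      apply (mul_eq_zero.1 _).resolve_left hk1
      linear_combination k * hf - A * e2 - C * e4 + x 6 * hroot
    simp only [x6] at e2 e4
    have x5 : x 5 = 0 := by
      apply (mul_eq_zero.1 _).resolve_left hk0
      linear_combination e2
    have x7 : x 7 = 0 := by
      apply (mul_eq_zero.1 _).resolve_left hk0
      linear_combination e4
    ext i
    fin_cases i <;> simp <;> linarith
  let e : ∀ w ∈ W, J2 ≃L[ℝ] Cof := fun w hw =>
    (LinearEquiv.ofInjectiveOfFinrankEq (L w).toLinearMap (hinj w hw)
      (by rw [finrank_Cof]; simp)).toContinuousLinearEquiv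
  have he : ∀ w hw, (e w hw : J2 →L[ℝ] Cof) = L w := fun w hw => rfl
  { coframe := L
    frame := fun w => (L w).inverse
    contDiffOn_coframe := hsm
    contDiffOn_frame := fun w hw => by
      have h1 := contDiffAt_map_inverse (n := ∞) (e w hw)
      rw [he w hw] at h1
      exact (h1.comp w (hsm.contDiffAt (hW.mem_nhds hw))).contDiffWithinAt
    frame_coframe := fun w hw x => by
      simp only [← he w hw, ContinuousLinearMap.inverse_equiv]
      simp
    coframe_frame := fun w hw y => by
      simp only [← he w hw, ContinuousLinearMap.inverse_equiv]
      simp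
    mem_distD_iff := fun w _ => hD w
    isIntegralElement_iff := fun w hw v => by
      rw [isIntegralElement_iff]
      refine and_congr_right fun hv => forall₂_congr fun a ha => forall₂_congr fun b hb => ?_
      have hfa := (mem_distD_iff.1 (hv ha)).1
      have hfb := (mem_distD_iff.1 (hv hb)).1
      rw [fderiv_eq_of_contact (mem_distD_iff.1 (hv ha)).2] at hfa
      rw [fderiv_eq_of_contact (mem_distD_iff.1 (hv hb)).2] at hfb
      simp only [hL, charCovector_apply]
      have hk0 := hk0 w hw
      have hk1 := hk1 w hw
      have hroot := hroot w hw
      generalize (totalDeriv F w).1 = G at *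
      generalize (totalDeriv F w).2 = H at *
      generalize partialDeriv F 5 w = A at *
      generalize partialDeriv F 6 w = B at *
      generalize partialDeriv F 7 w = C at *
      generalize k w = k at *
      -- both identities hold modulo the equation of `k` and the relation `dF = 0` on `D`
      have h1 : (k * a 0 - A * a 1) * (k * b 5 + C * b 6 + G * b 1)
          - (k * b 0 - A * b 1) * (k * a 5 + C * a 6 + G * a 1) =
          k * (k * ((a 0 * b 5 - b 0 * a 5) + (a 1 * b 6 - b 1 * a 6))
            + C * ((a 0 * b 6 - b 0 * a 6) + (a 1 * b 7 - b 1 * a 7))) := by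
        linear_combination (-k) * (a 1 * hfb - b 1 * hfa) - (a 1 * b 6 - b 1 * a 6) * hroot
      have h2 : (k * a 1 - C * a 0) * (A * b 6 + k * b 7 + H * b 0)
          - (k * b 1 - C * b 0) * (A * a 6 + k * a 7 + H * a 0) =
          k * (A * ((a 0 * b 5 - b 0 * a 5) + (a 1 * b 6 - b 1 * a 6))
            + k * ((a 0 * b 6 - b 0 * a 6) + (a 1 * b 7 - b 1 * a 7))) := by
        linear_combination (-k) * (a 0 * hfb - b 0 * hfa) - (a 0 * b 6 - b 0 * a 6) * hroot
      rw [h1, h2]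
      generalize (a 0 * b 5 - b 0 * a 5) + (a 1 * b 6 - b 1 * a 6) = ω₁
      generalize (a 0 * b 6 - b 0 * a 6) + (a 1 * b 7 - b 1 * a 7) = ω₂
      constructor
      · rintro ⟨rfl, rfl⟩
        simp
      · rintro ⟨h3, h4⟩
        have h3 := (mul_eq_zero.1 h3).resolve_left hk0
        have h4 := (mul_eq_zero.1 h4).resolve_left hk0
        constructor
        · apply (mul_eq_zero.1 _).resolve_left hk1
          linear_combination k * h3 - C * h4
        · apply (mul_eq_zero.1 _).resolve_left hk1
          linear_combination k * h4 - A * h3 }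

theorem exists_adaptedCoframe {Ω : Set J2} {F : J2 → ℝ} (hF : IsHyperbolicEquation Ω F) {w₀ : J2}
    (hw₀ : w₀ ∈ equation Ω F) :
    ∃ W, IsOpen W ∧ W ⊆ Ω ∧ w₀ ∈ W ∧ Nonempty (AdaptedCoframe F W) := by
  have hp := contDiffOn_partialDeriv hF.isOpen hF.smooth
  let d : J2 → ℝ := fun w =>
    partialDeriv F 6 w ^ 2 - 4 * (partialDeriv F 5 w * partialDeriv F 7 w)
  have hd : ContDiffOn ℝ ∞ d Ω := by simp only [d]; fun_prop
  have hd₀ : 0 < d w₀ := by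
    have := hF.hyperbolic w₀ hw₀
    simp only [discriminant] at this
    simp only [d]
    linarith
  -- the sign is chosen such that no cancellation occurs in the root
  obtain ⟨ε, hε, hε₀⟩ : ∃ ε : ℝ, ε ^ 2 = 1 ∧ 0 ≤ ε * partialDeriv F 6 w₀ := by
    rcases le_total 0 (partialDeriv F 6 w₀) with h | h
    · exact ⟨1, by norm_num, by simpa⟩
    · exact ⟨-1, by norm_num, by linarith⟩
  let k : J2 → ℝ := fun w => (partialDeriv F 6 w + ε * √(d w)) / 2
  have hk₀ : k w₀ ≠ 0 := by
    intro h
    have h1 : ε * partialDeriv F 6 w₀ + ε ^ 2 * √(d w₀) = 0 := by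
      simp only [k] at h; linear_combination 2 * ε * h
    rw [hε] at h1
    have := Real.sqrt_pos.2 hd₀
    linarith
  have hkc : ContinuousOn k Ω := by
    have h1 := (hp 6).continuousOn
    have h2 := Real.continuous_sqrt.comp_continuousOn hd.continuousOn
    simp only [k]
    exact (h1.add (continuousOn_const.mul h2)).div_const _
  let W : Set J2 := Ω ∩ (fun w => (d w, k w)) ⁻¹' (Set.Ioi 0 ×ˢ {0}ᶜ)
  have hWo : IsOpen W := (hd.continuousOn.prodMk hkc).isOpen_inter_preimage hF.isOpen
    (isOpen_Ioi.prod isOpen_compl_singleton)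
  have hWd : ∀ w ∈ W, 0 < d w := fun w hw => hw.2.1
  have hk : ContDiffOn ℝ ∞ k W := by
    have h1 : ContDiffOn ℝ ∞ (fun w => √(d w)) W :=
      (hd.mono Set.inter_subset_left).sqrt fun w hw => (hWd w hw).ne'
    have h2 := (hp 6).mono (t := W) Set.inter_subset_left
    simp only [k]
    fun_prop
  refine ⟨W, hWo, Set.inter_subset_left, ⟨hw₀.1, hd₀, hk₀⟩,
    ⟨adaptedCoframeOfRoot hWo (hF.smooth.mono Set.inter_subset_left) hk ?_ (fun w hw => hw.2.2) ?_⟩⟩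
  · intro w hw
    have h1 := Real.sq_sqrt (hWd w hw).le
    simp only [k]
    simp only [d] at h1 ⊢
    linear_combination ε ^ 2 / 4 * h1 + (partialDeriv F 6 w ^ 2
      - 4 * (partialDeriv F 5 w * partialDeriv F 7 w)) / 4 * hε
  · intro w hw h
    have h1 := Real.sq_sqrt (hWd w hw).le
    have h2 : k w * (ε * √(d w)) = 0 := by
      have h3 : k w ^ 2 - partialDeriv F 6 w * k w
          + partialDeriv F 5 w * partialDeriv F 7 w = 0 := by
        simp only [k]
        simp only [d] at h1 ⊢
        linear_combination ε ^ 2 / 4 * h1 + (partialDeriv F 6 w ^ 2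
          - 4 * (partialDeriv F 5 w * partialDeriv F 7 w)) / 4 * hε
      have h4 : ε * √(d w) = 2 * k w - partialDeriv F 6 w := by simp only [k]; ring
      rw [h4]
      linear_combination h + h3
    have h5 : ε ≠ 0 := by rintro rfl; norm_num at hε
    exact (mul_ne_zero hw.2.2 (mul_ne_zero h5 (Real.sqrt_pos.2 (hWd w hw)).ne')) h2

/-! ### Charts adapted to the equation and to the distribution -/

theorem exists_linearEquiv_snd_eq {ℓ : J2 →L[ℝ] ℝ} (hℓ : ℓ ≠ 0) :
    ∃ (p : J2 →L[ℝ] EuclideanSpace ℝ (Fin 7)) (N : J2 ≃L[ℝ] EuclideanSpace ℝ (Fin 7) × ℝ),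
      (N : J2 →L[ℝ] EuclideanSpace ℝ (Fin 7) × ℝ) = p.prod ℓ := by
  have hsurj : Function.Surjective ℓ.toLinearMap :=
    LinearMap.surjective (fun h => hℓ (by ext1 x; exact LinearMap.congr_fun h x))
  have hker : Module.finrank ℝ (LinearMap.ker ℓ.toLinearMap) = 7 := by
    have h := LinearMap.finrank_range_add_finrank_ker ℓ.toLinearMap
    rw [LinearMap.range_eq_top.2 hsurj, finrank_top] at h
    simp only [Module.finrank_self, finrank_euclideanSpace, Fintype.card_fin] at h
    omega
  obtain ⟨q, hq⟩ := Submodule.exists_isCompl (LinearMap.ker ℓ.toLinearMap)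
  let a : LinearMap.ker ℓ.toLinearMap ≃ₗ[ℝ] EuclideanSpace ℝ (Fin 7) :=
    LinearEquiv.ofFinrankEq _ _ (by rw [hker]; simp)
  let p : J2 →ₗ[ℝ] EuclideanSpace ℝ (Fin 7) :=
    a.toLinearMap ∘ₗ (LinearMap.ker ℓ.toLinearMap).projectionOnto q hq
  have hinj : Function.Injective (p.prod ℓ.toLinearMap) := by
    rw [injective_iff_map_eq_zero]
    intro x hx
    have h1 : p x = 0 := congrArg Prod.fst hx
    have h2 : x ∈ LinearMap.ker ℓ.toLinearMap := congrArg Prod.snd hx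
    have h3 : x ∈ q := by
      rw [← Submodule.projectionOnto_apply_eq_zero_iff hq]
      simpa [p] using h1
    exact Submodule.disjoint_def.1 hq.disjoint x h2 h3
  refine ⟨p.toContinuousLinearMap, (LinearEquiv.ofInjectiveOfFinrankEq _ hinj
    (by simp)).toContinuousLinearEquiv, ?_⟩
  rfl

/-- Local coordinates of `J2` with last coordinate a given function of nonzero differential. -/
theorem exists_chart_snd_eq {Ω : Set J2} (hΩ : IsOpen Ω) {F : J2 → ℝ} (hF : ContDiffOn ℝ ∞ F Ω)
    {w₀ : J2} (hw₀ : w₀ ∈ Ω) (h : fderiv ℝ F w₀ ≠ 0) :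
    ∃ φ : OpenPartialHomeomorph J2 (EuclideanSpace ℝ (Fin 7) × ℝ), w₀ ∈ φ.source ∧
      φ.source ⊆ Ω ∧ ContDiffOn ℝ ∞ φ φ.source ∧ ContDiffOn ℝ ∞ φ.symm φ.target ∧
      ∀ w ∈ φ.source, (φ w).2 = F w := by
  obtain ⟨p, N, hN⟩ := exists_linearEquiv_snd_eq h
  let f : J2 → EuclideanSpace ℝ (Fin 7) × ℝ := fun w => (p w, F w)
  have hf : ContDiffOn ℝ ∞ f Ω := p.contDiff.contDiffOn.prodMk hF
  have hd : ∀ w ∈ Ω, HasFDerivAt f (p.prod (fderiv ℝ F w)) w := fun w hw =>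
    p.hasFDerivAt.prodMk
      ((hF.contDiffAt (hΩ.mem_nhds hw)).differentiableAt (by simp)).hasFDerivAt
  have hd₀ : HasFDerivAt f (N : J2 →L[ℝ] EuclideanSpace ℝ (Fin 7) × ℝ) w₀ := by
    rw [hN]; exact hd w₀ hw₀
  have hc₀ := hf.contDiffAt (hΩ.mem_nhds hw₀)
  let ψ := hc₀.toOpenPartialHomeomorph f hd₀ (by simp)
  -- the set of points at which the derivative is invertible
  let D : J2 → (J2 →L[ℝ] EuclideanSpace ℝ (Fin 7) × ℝ) := fun w => p.prod (fderiv ℝ F w)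
  let U : Set J2 := Ω ∩ D ⁻¹' Set.range ((↑) : (J2 ≃L[ℝ] EuclideanSpace ℝ (Fin 7) × ℝ) → _)
  have hD : ContinuousOn D Ω := by
    have h1 : ContDiffOn ℝ ∞ D Ω := by
      rw [contDiffOn_clm_apply]
      intro y
      exact contDiffOn_const.prodMk
        ((hF.fderiv_of_isOpen (m := ∞) hΩ (by simp)).clm_apply contDiffOn_const)
    exact h1.continuousOn
  have hU : IsOpen U := hD.isOpen_inter_preimage hΩ ContinuousLinearEquiv.isOpen
  have hw₀U : w₀ ∈ U := ⟨hw₀, N, hN⟩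
  have hmem : w₀ ∈ ψ.source := hc₀.mem_toOpenPartialHomeomorph_source hd₀ (by simp)
  have hsub : (ψ.restrOpen U hU).source ⊆ U := by
    rw [ψ.restrOpen_source]; exact Set.inter_subset_right
  refine ⟨ψ.restrOpen U hU, ?_, fun w hw => (hsub hw).1, ?_, ?_, fun w _ => rfl⟩
  · rw [ψ.restrOpen_source]; exact ⟨hmem, hw₀U⟩
  · exact hf.mono fun w hw => (hsub hw).1
  · intro y hy
    have hw := hsub ((ψ.restrOpen U hU).map_target hy)
    obtain ⟨e, he⟩ := hw.2
    refine ((ψ.restrOpen U hU).contDiffAt_symm (f₀' := e) hy ?_ ?_).contDiffWithinAt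
    · rw [he]; exact hd _ hw.1
    · exact hf.contDiffAt (hΩ.mem_nhds hw.1)

/-- In the linear coordinates `A` of `J2` the subspace `v` is the graph of `T`. -/
def IsGraphOf {K : Type*} [NormedAddCommGroup K] [NormedSpace ℝ K] (A : J2 →L[ℝ] E2 × K)
    (v : Submodule ℝ J2) (T : E2 →L[ℝ] K) : Prop :=
  ∀ x, x ∈ v ↔ (A x).2 = T (A x).1

section Graph

variable {K : Type*} [NormedAddCommGroup K] [NormedSpace ℝ K]

theorem IsGraphOf.unique {A : J2 →L[ℝ] E2 × K} (hA : Function.Surjective A)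
    {v : Submodule ℝ J2} {T T' : E2 →L[ℝ] K} (h : IsGraphOf A v T) (h' : IsGraphOf A v T') :
    T = T' := by
  ext1 y
  obtain ⟨x, hx⟩ := hA (y, T y)
  have h1 : x ∈ v := (h x).2 (by rw [hx])
  have h2 := (h' x).1 h1
  rwa [hx] at h2

theorem isGraphOf_of_isUnit {A : J2 →L[ℝ] E2 × K} (hA : Function.Injective A)
    {v : Submodule ℝ J2} {B : E2 →L[ℝ] J2} (hv : v = B.range)
    (hu : IsUnit ((ContinuousLinearMap.fst ℝ E2 K ∘L A) ∘L B)) :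
    IsGraphOf A v (((ContinuousLinearMap.snd ℝ E2 K ∘L A) ∘L B) ∘L
      Ring.inverse ((ContinuousLinearMap.fst ℝ E2 K ∘L A) ∘L B)) := by
  have h1 : ∀ y, Ring.inverse ((ContinuousLinearMap.fst ℝ E2 K ∘L A) ∘L B) (A (B y)).1 = y :=
    fun y => DFunLike.congr_fun (Ring.inverse_mul_cancel _ hu) y
  have h2 : ∀ y, (A (B (Ring.inverse ((ContinuousLinearMap.fst ℝ E2 K ∘L A) ∘L B) y))).1 = y :=
    fun y => DFunLike.congr_fun (Ring.mul_inverse_cancel _ hu) y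
  intro x
  change _ ↔ (A x).2 = (A (B (Ring.inverse
    ((ContinuousLinearMap.fst ℝ E2 K ∘L A) ∘L B) (A x).1))).2
  rw [hv]
  constructor
  · rintro ⟨y, rfl⟩
    exact (congrArg (fun z => (A (B z)).2) (h1 y)).symm
  · intro hx
    exact ⟨_, hA (Prod.ext (h2 _) hx.symm)⟩

theorem IsGraphOf.isUnit {A : J2 →L[ℝ] E2 × K} (hA : Function.Injective A)
    {v : Plane} {B : E2 →L[ℝ] J2} (hv : v.1 = B.range) {T : E2 →L[ℝ] K}
    (h : IsGraphOf A v.1 T) : IsUnit ((ContinuousLinearMap.fst ℝ E2 K ∘L A) ∘L B) := by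
  apply isUnit_of_injective
  rw [injective_iff_map_eq_zero]
  intro y hy
  have hy' : (A (B y)).1 = 0 := hy
  have h1 := (h (B y)).1 (by rw [hv]; exact ⟨y, rfl⟩)
  rw [hy', map_zero] at h1
  have h2 : B y = 0 := (injective_iff_map_eq_zero A).1 hA _ (Prod.ext hy' h1)
  exact (injective_iff_map_eq_zero B).1 (injective_of_range_eq hv) y h2

/-- The parametrization `y ↦ A⁻¹ (y, T y)` of a graph. -/
noncomputable def graphFrame (A' : E2 × K →L[ℝ] J2) (T : E2 →L[ℝ] K) : E2 →L[ℝ] J2 :=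
  A' ∘L (ContinuousLinearMap.inl ℝ E2 K + ContinuousLinearMap.inr ℝ E2 K ∘L T)

theorem graphFrame_apply (A' : E2 × K →L[ℝ] J2) (T : E2 →L[ℝ] K) (y : E2) :
    graphFrame A' T y = A' (y, T y) := by
  simp [graphFrame, ← map_add]

theorem isGraphOf_range_graphFrame {A : J2 →L[ℝ] E2 × K} {A' : E2 × K →L[ℝ] J2}
    (h : ∀ x, A' (A x) = x) (h' : ∀ y, A (A' y) = y) (T : E2 →L[ℝ] K) :
    IsGraphOf A (graphFrame A' T).range T := by
  intro x
  constructor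
  · rintro ⟨y, rfl⟩
    have h1 : A (graphFrame A' T y) = (y, T y) := by rw [graphFrame_apply, h']
    have h2 : (A (graphFrame A' T y)).2 = T (A (graphFrame A' T y)).1 := by rw [h1]
    exact h2
  · intro hx
    refine ⟨(A x).1, (graphFrame_apply _ _ _).trans ?_⟩
    rw [← hx]
    exact h x

theorem graphFrame_injective {A : J2 →L[ℝ] E2 × K} {A' : E2 × K →L[ℝ] J2}
    (h' : ∀ y, A (A' y) = y) (T : E2 →L[ℝ] K) : Function.Injective (graphFrame A' T) := by
  intro y z hyz
  rw [graphFrame_apply, graphFrame_apply] at hyz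
  have := congrArg A hyz
  rw [h', h'] at this
  exact congrArg Prod.fst this

open Classical in
/-- The range of an injective linear map, as a plane; the plane `v₀` is a junk value. -/
noncomputable def planeOfRange (v₀ : Plane) (B : E2 →L[ℝ] J2) : Plane :=
  if h : Module.finrank ℝ B.range = 2 then ⟨B.range, h⟩ else v₀

theorem coe_planeOfRange (v₀ : Plane) {B : E2 →L[ℝ] J2} (h : Function.Injective B) :
    (planeOfRange v₀ B).1 = B.range := by
  have h1 : Module.finrank ℝ B.range = 2 :=
    (LinearMap.finrank_range_of_inj (f := B.toLinearMap) h).trans (by simp)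
  exact congrArg Subtype.val (dif_pos h1)

end Graph

section BundleChart

variable {K X : Type*} [NormedAddCommGroup K] [NormedSpace ℝ K]
  [NormedAddCommGroup X] [NormedSpace ℝ X]

/-- A smooth field of linear coordinates `J2 ≃ ℝ² × K` over `W`. -/
structure LinearCoords (K : Type*) [NormedAddCommGroup K] [NormedSpace ℝ K] (W : Set J2) where
  coords : J2 → (J2 →L[ℝ] E2 × K)
  inv : J2 → (E2 × K →L[ℝ] J2)
  contDiffOn_coords : ContDiffOn ℝ ∞ coords W
  contDiffOn_inv : ContDiffOn ℝ ∞ inv W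
  inv_coords : ∀ w ∈ W, ∀ x, inv w (coords w x) = x
  coords_inv : ∀ w ∈ W, ∀ y, coords w (inv w y) = y

/-- Near a pair `(w₀, v₀)` such that `v₀` is a graph in the coordinates at `w₀`, all nearby planes are
graphs, with smooth coefficients. -/
theorem LinearCoords.exists_smooth_graph {W : Set J2} (hW : IsOpen W) (A : LinearCoords K W)
    {u₀ : J2 × Plane} (hu₀ : u₀.1 ∈ W) {T₀ : E2 →L[ℝ] K} (hT₀ : IsGraphOf (A.coords u₀.1) u₀.2.1 T₀) :
    ∃ T : J2 × Plane → (E2 →L[ℝ] K),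
      ContMDiffAt (𝓘(ℝ, J2).prod 𝓘(ℝ, E2 →L[ℝ] E6)) 𝓘(ℝ, E2 →L[ℝ] K) ∞ T u₀ ∧
      ∀ᶠ u in nhds u₀, IsGraphOf (A.coords u.1) u.2.1 (T u) := by
  obtain ⟨B, hB, hBr⟩ := exists_smooth_frame u₀.2
  have hA : ContMDiffAt (𝓘(ℝ, J2).prod 𝓘(ℝ, E2 →L[ℝ] E6)) 𝓘(ℝ, J2 →L[ℝ] E2 × K) ∞
      (fun u : J2 × Plane => A.coords u.1) u₀ :=
    (A.contDiffOn_coords.contDiffAt (hW.mem_nhds hu₀)).contMDiffAt.comp u₀ contMDiffAt_fst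
  have hB' : ContMDiffAt (𝓘(ℝ, J2).prod 𝓘(ℝ, E2 →L[ℝ] E6)) 𝓘(ℝ, E2 →L[ℝ] J2) ∞
      (fun u : J2 × Plane => B u.2) u₀ :=
    hB.comp u₀ contMDiffAt_snd
  have hp := (contMDiffAt_const (c := ContinuousLinearMap.fst ℝ E2 K)).clm_comp hA
    |>.clm_comp hB'
  have hq := (contMDiffAt_const (c := ContinuousLinearMap.snd ℝ E2 K)).clm_comp hA
    |>.clm_comp hB'
  have hinj : ∀ w ∈ W, Function.Injective (A.coords w) := fun w hw =>
    Function.LeftInverse.injective (A.inv_coords w hw)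
  have hu : IsUnit ((ContinuousLinearMap.fst ℝ E2 K ∘L A.coords u₀.1) ∘L B u₀.2) :=
    hT₀.isUnit (hinj _ hu₀) hBr.self_of_nhds
  refine ⟨_, hq.clm_comp (contMDiffAt_ringInverse_comp hp hu), ?_⟩
  filter_upwards [hp.continuousAt.eventually (Units.isOpen.mem_nhds hu),
    continuous_snd.continuousAt.eventually hBr,
    continuous_fst.continuousAt.eventually (hW.mem_nhds hu₀)] with u h1 h2 h3
  exact isGraphOf_of_isUnit (hinj _ h3) h2 h1

/-- Coordinates of the Grassmann bundle of `J2`, built from coordinates `φ` of `J2` and linear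
coordinates `A` that vary with the point: the pair `(w, v)` has coordinates `(φ w, T)`, where `v` is
the graph of `T` with respect to `A w`. -/
theorem LinearCoords.exists_bundleChart {W : Set J2} (hW : IsOpen W) (A : LinearCoords K W)
    (φ : OpenPartialHomeomorph J2 X) (hφ : ContDiffOn ℝ ∞ φ φ.source)
    (hφ' : ContDiffOn ℝ ∞ φ.symm φ.target) (v₀ : Plane) :
    ∃ Φ : OpenPartialHomeomorph (J2 × Plane) (X × (E2 →L[ℝ] K)),
      Φ.source = {u | u.1 ∈ φ.source ∩ W ∧ ∃ T, IsGraphOf (A.coords u.1) u.2.1 T} ∧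
      (∀ u ∈ Φ.source, (Φ u).1 = φ u.1 ∧ IsGraphOf (A.coords u.1) u.2.1 (Φ u).2) ∧
      ContMDiffOn (𝓘(ℝ, J2).prod 𝓘(ℝ, E2 →L[ℝ] E6)) 𝓘(ℝ, X × (E2 →L[ℝ] K)) ∞ Φ Φ.source ∧
      ContMDiffOn 𝓘(ℝ, X × (E2 →L[ℝ] K)) (𝓘(ℝ, J2).prod 𝓘(ℝ, E2 →L[ℝ] E6)) ∞ Φ.symm
        Φ.target := by
  let S : Set (J2 × Plane) :=
    {u | u.1 ∈ φ.source ∩ W ∧ ∃ T, IsGraphOf (A.coords u.1) u.2.1 T}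
  let R : Set (X × (E2 →L[ℝ] K)) := {y | y.1 ∈ φ.target ∩ φ.symm ⁻¹' W}
  let f : J2 × Plane → X × (E2 →L[ℝ] K) := fun u =>
    (φ u.1, Classical.epsilon fun T => IsGraphOf (A.coords u.1) u.2.1 T)
  let g : X × (E2 →L[ℝ] K) → J2 × Plane := fun y =>
    (φ.symm y.1, planeOfRange v₀ (graphFrame (A.inv (φ.symm y.1)) y.2))
  have hinj : ∀ w ∈ W, Function.Injective (A.coords w) := fun w hw =>
    Function.LeftInverse.injective (A.inv_coords w hw)
  have hsurj : ∀ w ∈ W, Function.Surjective (A.coords w) := fun w hw =>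
    Function.RightInverse.surjective (A.coords_inv w hw)
  have hfT : ∀ u ∈ S, ∀ T, IsGraphOf (A.coords u.1) u.2.1 T → f u = (φ u.1, T) := by
    intro u hu T hT
    exact Prod.ext rfl ((Classical.epsilon_spec (p := fun T => IsGraphOf (A.coords u.1) u.2.1 T)
      ⟨T, hT⟩).unique (hsurj _ hu.1.2) hT)
  have hg : ∀ y ∈ R, (g y).2.1 = (graphFrame (A.inv (φ.symm y.1)) y.2).range := by
    intro y hy
    exact coe_planeOfRange v₀ (graphFrame_injective (A.coords_inv _ hy.2) _)
  have hgG : ∀ y ∈ R, IsGraphOf (A.coords (g y).1) (g y).2.1 y.2 := by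
    intro y hy
    rw [hg y hy]
    exact isGraphOf_range_graphFrame (A.inv_coords _ hy.2) (A.coords_inv _ hy.2) _
  have hgS : ∀ y ∈ R, g y ∈ S := fun y hy => ⟨⟨φ.map_target hy.1, hy.2⟩, _, hgG y hy⟩
  have hSo : IsOpen S := by
    rw [isOpen_iff_mem_nhds]
    rintro u ⟨hu, T₀, hT₀⟩
    obtain ⟨T, -, hT⟩ := A.exists_smooth_graph hW hu.2 hT₀
    filter_upwards [hT, continuous_fst.continuousAt.eventually
      ((φ.open_source.inter hW).mem_nhds hu)] with u' h1 h2
    exact ⟨h2, _, h1⟩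
  have hRo : IsOpen R := (φ.isOpen_inter_preimage_symm hW).preimage continuous_fst
  have hfs : ContMDiffOn (𝓘(ℝ, J2).prod 𝓘(ℝ, E2 →L[ℝ] E6)) 𝓘(ℝ, X × (E2 →L[ℝ] K)) ∞ f S := by
    rintro u hu
    obtain ⟨T₀, hT₀⟩ := hu.2
    obtain ⟨T, hTs, hT⟩ := A.exists_smooth_graph hW hu.1.2 hT₀
    have h1 : ContMDiffAt (𝓘(ℝ, J2).prod 𝓘(ℝ, E2 →L[ℝ] E6)) 𝓘(ℝ, X) ∞
        (fun u : J2 × Plane => φ u.1) u :=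
      (hφ.contDiffAt (φ.open_source.mem_nhds hu.1.1)).contMDiffAt.comp u contMDiffAt_fst
    refine ((h1.prodMk_space hTs).congr_of_eventuallyEq ?_).contMDiffWithinAt
    filter_upwards [hT, hSo.mem_nhds hu] with u' h2 h3
    exact hfT u' h3 _ h2
  have hgs : ContMDiffOn 𝓘(ℝ, X × (E2 →L[ℝ] K)) (𝓘(ℝ, J2).prod 𝓘(ℝ, E2 →L[ℝ] E6)) ∞ g R := by
    intro y hy
    have h1 : ContDiffAt ℝ ∞ (fun y : X × (E2 →L[ℝ] K) => φ.symm y.1) y :=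
      (hφ'.contDiffAt (φ.open_target.mem_nhds hy.1)).comp y contDiffAt_fst
    have h2 : ContDiffAt ℝ ∞ (fun y : X × (E2 →L[ℝ] K) => A.inv (φ.symm y.1)) y :=
      (A.contDiffOn_inv.contDiffAt (hW.mem_nhds hy.2)).comp y h1
    have h3 : ContDiffAt ℝ ∞
        (fun y : X × (E2 →L[ℝ] K) => graphFrame (A.inv (φ.symm y.1)) y.2) y :=
      h2.clm_comp (contDiffAt_const.add (contDiffAt_const.clm_comp contDiffAt_snd))
    refine (h1.contMDiffAt.prodMk (contMDiffAt_plane_of_range h3.contMDiffAt ?_)).contMDiffWithinAt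
    filter_upwards [hRo.mem_nhds hy] with y' hy'
    exact hg y' hy'
  let Φ : OpenPartialHomeomorph (J2 × Plane) (X × (E2 →L[ℝ] K)) :=
    { toFun := f
      invFun := g
      source := S
      target := R
      map_source' := fun u hu => ⟨φ.map_source hu.1.1, by
        change φ.symm (φ u.1) ∈ W
        rw [φ.left_inv hu.1.1]
        exact hu.1.2⟩
      map_target' := hgS
      left_inv' := fun u hu => by
        obtain ⟨T, hT⟩ := hu.2
        have hR : (φ u.1, T) ∈ R := ⟨φ.map_source hu.1.1, by
          change φ.symm (φ u.1) ∈ W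
          rw [φ.left_inv hu.1.1]
          exact hu.1.2⟩
        have h1 : (g (φ u.1, T)).1 = u.1 := φ.left_inv hu.1.1
        have h2 := hgG _ hR
        rw [h1] at h2
        rw [hfT u hu T hT]
        refine Prod.ext h1 (Subtype.ext ?_)
        ext x
        exact (h2 x).trans (hT x).symm
      right_inv' := fun y hy => by
        rw [hfT _ (hgS y hy) _ (hgG y hy)]
        exact Prod.ext (φ.right_inv hy.1) rfl
      open_source := hSo
      open_target := hRo
      continuousOn_toFun := hfs.continuousOn
      continuousOn_invFun := hgs.continuousOn }
  refine ⟨Φ, rfl, fun u hu => ⟨rfl, ?_⟩, hfs, hgs⟩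
  exact Classical.epsilon_spec (p := fun T => IsGraphOf (A.coords u.1) u.2.1 T) hu.2

end BundleChart

/-! ### Slice charts of the Grassmann bundle and of the prolongation -/

/-- The coordinates transversal to the Grassmann bundle: the value of `F`, and the components
of a plane transversal to `D`. -/
abbrev NormalModel : Type := ℝ × (E2 →L[ℝ] ℝ × (Fin 3 → ℝ))

/-- Linear coordinates of `J2` from an adapted coframe and linear coordinates `n` of `D ≅ ℂ × ℂ`. -/
noncomputable def AdaptedCoframe.linearCoords {F : J2 → ℝ} {W : Set J2} (C : AdaptedCoframe F W)
    (n : (ℂ × ℂ) ≃L[ℝ] E2 × (ℝ × ℝ)) : LinearCoords ((ℝ × ℝ) × (ℝ × (Fin 3 → ℝ))) W :=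
  let m : Cof ≃L[ℝ] E2 × ((ℝ × ℝ) × (ℝ × (Fin 3 → ℝ))) :=
    (n.prodCongr (.refl ℝ _)).trans (ContinuousLinearEquiv.prodAssoc ℝ _ _ _)
  { coords := fun w => (m : Cof →L[ℝ] _) ∘L C.coframe w
    inv := fun w => C.frame w ∘L (m.symm : E2 × ((ℝ × ℝ) × (ℝ × (Fin 3 → ℝ))) →L[ℝ] Cof)
    contDiffOn_coords := contDiffOn_const.clm_comp C.contDiffOn_coframe
    contDiffOn_inv := C.contDiffOn_frame.clm_comp contDiffOn_const
    inv_coords := fun w hw x => by simp [C.frame_coframe w hw]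
    coords_inv := fun w hw y => by simp [C.coframe_frame w hw] }

theorem AdaptedCoframe.linearCoords_apply {F : J2 → ℝ} {W : Set J2} (C : AdaptedCoframe F W)
    (n : (ℂ × ℂ) ≃L[ℝ] E2 × (ℝ × ℝ)) (w x : J2) : (C.linearCoords n).coords w x =
      ((n (C.coframe w x).1).1, ((n (C.coframe w x).1).2, (C.coframe w x).2)) := rfl

theorem IsGraphOf.exists_mem {K : Type*} [NormedAddCommGroup K] [NormedSpace ℝ K]
    {A : J2 →L[ℝ] E2 × K} (hA : Function.Surjective A) {v : Submodule ℝ J2} {T : E2 →L[ℝ] K}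
    (h : IsGraphOf A v T) (y : E2) : ∃ x ∈ v, A x = (y, T y) := by
  obtain ⟨x, hx⟩ := hA (y, T y)
  exact ⟨x, (h x).2 (by rw [hx]), hx⟩

/-- A plane contained in the graph of `0` is equal to it. -/
theorem isGraphOf_zero_of_le {K : Type*} [NormedAddCommGroup K] [NormedSpace ℝ K]
    {A : J2 →L[ℝ] E2 × K} {A' : E2 × K →L[ℝ] J2} (h : ∀ x, A' (A x) = x)
    (h' : ∀ y, A (A' y) = y) {v : Plane} (hv : ∀ x ∈ v.1, (A x).2 = 0) : IsGraphOf A v.1 0 := by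
  have h1 := isGraphOf_range_graphFrame h h' 0
  have h2 : v.1 = (graphFrame A' (0 : E2 →L[ℝ] K)).range := by
    refine Submodule.eq_of_le_of_finrank_eq (fun x hx => (h1 x).2 (by simpa using hv x hx)) ?_
    rw [v.2]
    exact ((LinearMap.finrank_range_of_inj (f := (graphFrame A' (0 : E2 →L[ℝ] K)).toLinearMap)
      (graphFrame_injective h' 0)).trans (by simp)).symm
  rwa [h2]

/-- A plane on which `Re ζ ∧ Im ζ` vanishes contains a nonzero vector on which `ζ` vanishes. -/
theorem exists_ne_zero_of_wedge_eq_zero (v : Plane) (ζ : J2 →L[ℝ] ℂ)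
    (h : ∀ a ∈ v.1, ∀ b ∈ v.1, (ζ a).re * (ζ b).im - (ζ b).re * (ζ a).im = 0) :
    ∃ x ∈ v.1, x ≠ 0 ∧ ζ x = 0 := by
  by_contra! hcon
  let f : v.1 →ₗ[ℝ] ℂ := ζ.toLinearMap ∘ₗ v.1.subtype
  have hf : Function.Injective f := by
    rw [injective_iff_map_eq_zero]
    rintro ⟨x, hx⟩ hfx
    by_contra hne
    exact hcon x hx (fun h0 => hne (Subtype.ext h0)) hfx
  have hs : Function.Surjective f := by
    rwa [← LinearMap.injective_iff_surjective_of_finrank_eq_finrank]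
    rw [v.2, Complex.finrank_real_complex]
  obtain ⟨a, ha⟩ := hs 1
  obtain ⟨b, hb⟩ := hs Complex.I
  have h1 := h a a.2 b b.2
  have ha' : ζ a = 1 := ha
  have hb' : ζ b = Complex.I := hb
  rw [ha', hb'] at h1
  simp at h1

/-- Linear coordinates of `ℂ × ℂ` in which a given plane is horizontal. -/
theorem exists_linearEquiv_of_finrank_eq_two {P : Submodule ℝ (ℂ × ℂ)}
    (hP : Module.finrank ℝ P = 2) :
    ∃ n : (ℂ × ℂ) ≃L[ℝ] E2 × (ℝ × ℝ), ∀ z ∈ P, (n z).2 = 0 := by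
  obtain ⟨Q, hQ⟩ := Submodule.exists_isCompl P
  have hQ2 : Module.finrank ℝ Q = 2 := by
    have h := Submodule.finrank_add_eq_of_isCompl hQ
    rw [hP] at h
    simp only [Module.finrank_prod, Complex.finrank_real_complex] at h
    omega
  let a : P ≃ₗ[ℝ] E2 := LinearEquiv.ofFinrankEq _ _ (by rw [hP]; simp)
  let b : Q ≃ₗ[ℝ] ℝ × ℝ := LinearEquiv.ofFinrankEq _ _ (by rw [hQ2]; simp)
  refine ⟨((Submodule.prodEquivOfIsCompl P Q hQ).symm.trans
    (a.prodCongr b)).toContinuousLinearEquiv, fun z hz => ?_⟩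
  change b ((Submodule.prodEquivOfIsCompl P Q hQ).symm z).2 = 0
  rw [(Submodule.prodEquivOfIsCompl_symm_apply_snd_eq_zero P Q hQ).2 hz, map_zero]

/-- Linear coordinates of `ℂ × ℂ` in which the product of the two real lines `c₁⁻¹ ℝ` and `c₂⁻¹ ℝ` is
horizontal. -/
theorem exists_linearEquiv_mul {c₁ c₂ : ℂ} (h₁ : c₁ ≠ 0) (h₂ : c₂ ≠ 0) :
    ∃ n : (ℂ × ℂ) ≃L[ℝ] E2 × (ℝ × ℝ), ∀ z, (n z).1 0 = (z.1 * c₁).re ∧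
      (n z).1 1 = (z.2 * c₂).re ∧ (n z).2 = ((z.1 * c₁).im, (z.2 * c₂).im) := by
  let f : (ℂ × ℂ) →ₗ[ℝ] E2 × (ℝ × ℝ) :=
    { toFun := fun z => (!₂[(z.1 * c₁).re, (z.2 * c₂).re], ((z.1 * c₁).im, (z.2 * c₂).im))
      map_add' := fun z z' => by
        refine Prod.ext ?_ (by ext <;> simp <;> ring)
        ext i
        fin_cases i <;> simp <;> ring
      map_smul' := fun r z => by
        refine Prod.ext ?_ (by ext <;> simp <;> ring)
        ext i
        fin_cases i <;> simp <;> ring }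
  have hf : Function.Injective f := by
    rw [injective_iff_map_eq_zero]
    intro z hz
    have e1 : (z.1 * c₁).re = 0 := congrArg (fun y : E2 × (ℝ × ℝ) => y.1 0) hz
    have e2 : (z.2 * c₂).re = 0 := congrArg (fun y : E2 × (ℝ × ℝ) => y.1 1) hz
    have e3 : (z.1 * c₁).im = 0 := congrArg (fun y : E2 × (ℝ × ℝ) => y.2.1) hz
    have e4 : (z.2 * c₂).im = 0 := congrArg (fun y : E2 × (ℝ × ℝ) => y.2.2) hz
    have e5 : z.1 * c₁ = 0 := Complex.ext e1 e3
    have e6 : z.2 * c₂ = 0 := Complex.ext e2 e4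
    exact Prod.ext ((mul_eq_zero.1 e5).resolve_right h₁) ((mul_eq_zero.1 e6).resolve_right h₂)
  exact ⟨(LinearEquiv.ofInjectiveOfFinrankEq f hf
    (by simp [Complex.finrank_real_complex])).toContinuousLinearEquiv, fun z => ⟨rfl, rfl, rfl⟩⟩

/-- The coefficients of a linear map `ℝ² → ℝ²`, the diagonal ones first. -/
theorem exists_linearEquiv_coeff : ∃ m : (E2 →L[ℝ] ℝ × ℝ) ≃L[ℝ] (ℝ × ℝ) × (ℝ × ℝ),
    ∀ T, (m T).2 = ((T (EuclideanSpace.single 1 1)).1, (T (EuclideanSpace.single 0 1)).2) := by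
  let f : (E2 →L[ℝ] ℝ × ℝ) →ₗ[ℝ] (ℝ × ℝ) × (ℝ × ℝ) :=
    { toFun := fun T =>
        (((T (EuclideanSpace.single 0 1)).1, (T (EuclideanSpace.single 1 1)).2),
          ((T (EuclideanSpace.single 1 1)).1, (T (EuclideanSpace.single 0 1)).2))
      map_add' := fun _ _ => rfl
      map_smul' := fun _ _ => rfl }
  have hf : Function.Injective f := by
    rw [injective_iff_map_eq_zero]
    intro T hT
    have e0 : T (EuclideanSpace.single 0 1) = 0 :=
      Prod.ext (congrArg (fun y => y.1.1) hT) (congrArg (fun y => y.2.2) hT)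
    have e1 : T (EuclideanSpace.single 1 1) = 0 :=
      Prod.ext (congrArg (fun y => y.2.1) hT) (congrArg (fun y => y.1.2) hT)
    have h : T.toLinearMap = 0 := (EuclideanSpace.basisFun (Fin 2) ℝ).toBasis.ext fun i => by
      fin_cases i
      · simpa using e0
      · simpa using e1
    ext1 x
    exact LinearMap.congr_fun h x
  have hdim : Module.finrank ℝ (E2 →L[ℝ] ℝ × ℝ) = Module.finrank ℝ ((ℝ × ℝ) × (ℝ × ℝ)) := by
    rw [← (LinearMap.toContinuousLinearMap (𝕜 := ℝ) (E := E2) (F' := ℝ × ℝ)).finrank_eq]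
    simp [Module.finrank_linearMap]
  exact ⟨(LinearEquiv.ofInjectiveOfFinrankEq f hf hdim).toContinuousLinearEquiv, fun _ => rfl⟩

/-- A rearrangement of the coordinates of the Grassmann bundle: the first nine are coordinates
along the prolongation, the next two are coordinates along `J(D, 2)`. -/
theorem exists_linearEquiv_flag :
    ∃ m : ((EuclideanSpace ℝ (Fin 7) × ℝ) × (E2 →L[ℝ] (ℝ × ℝ) × (ℝ × (Fin 3 → ℝ)))) ≃L[ℝ]
        (EuclideanSpace ℝ (Fin 9) × (ℝ × ℝ)) × NormalModel,
      ∀ y, (m y).1.2 = ((y.2 (EuclideanSpace.single 1 1)).1.1,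
        (y.2 (EuclideanSpace.single 0 1)).1.2) ∧
        (m y).2 = (y.1.2, ContinuousLinearMap.snd ℝ (ℝ × ℝ) (ℝ × (Fin 3 → ℝ)) ∘L y.2) := by
  obtain ⟨c, hc⟩ := exists_linearEquiv_coeff
  let κ : (EuclideanSpace ℝ (Fin 7) × (ℝ × ℝ)) ≃ₗ[ℝ] EuclideanSpace ℝ (Fin 9) :=
    LinearEquiv.ofFinrankEq _ _ (by simp)
  let f : ((EuclideanSpace ℝ (Fin 7) × ℝ) × (E2 →L[ℝ] (ℝ × ℝ) × (ℝ × (Fin 3 → ℝ)))) ≃ₗ[ℝ]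
        (EuclideanSpace ℝ (Fin 9) × (ℝ × ℝ)) × NormalModel :=
    { toFun := fun y =>
        let t := c (ContinuousLinearMap.fst ℝ (ℝ × ℝ) (ℝ × (Fin 3 → ℝ)) ∘L y.2)
        ((κ (y.1.1, t.1), t.2),
          (y.1.2, ContinuousLinearMap.snd ℝ (ℝ × ℝ) (ℝ × (Fin 3 → ℝ)) ∘L y.2))
      map_add' := fun y y' => by
        simp only [Prod.fst_add, Prod.snd_add, ContinuousLinearMap.comp_add, map_add,
          Prod.mk_add_mk, ← map_add κ]
      map_smul' := fun r y => by
        simp only [Prod.smul_fst, Prod.smul_snd, ContinuousLinearMap.comp_smul, map_smul,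
          Prod.smul_mk, ← map_smul κ, RingHom.id_apply]
      invFun := fun z =>
        (((κ.symm z.1.1).1, z.2.1), (c.symm ((κ.symm z.1.1).2, z.1.2)).prod z.2.2)
      left_inv := fun y => by
        ext <;> simp
      right_inv := fun z => by
        ext <;> simp }
  exact ⟨f.toContinuousLinearEquiv, fun y => ⟨hc _, rfl⟩⟩

theorem LinearCoords.surjective {K : Type*} [NormedAddCommGroup K] [NormedSpace ℝ K] {W : Set J2}
    (A : LinearCoords K W) {w : J2} (hw : w ∈ W) : Function.Surjective (A.coords w) :=
  Function.RightInverse.surjective (A.coords_inv w hw)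

namespace AdaptedCoframe

variable {F : J2 → ℝ} {W : Set J2} (C : AdaptedCoframe F W)

theorem le_distD_iff {n : (ℂ × ℂ) ≃L[ℝ] E2 × (ℝ × ℝ)} {w : J2} (hw : w ∈ W)
    {v : Submodule ℝ J2} {T : E2 →L[ℝ] (ℝ × ℝ) × (ℝ × (Fin 3 → ℝ))}
    (hT : IsGraphOf ((C.linearCoords n).coords w) v T) :
    v ≤ distD F w ↔ ContinuousLinearMap.snd ℝ (ℝ × ℝ) (ℝ × (Fin 3 → ℝ)) ∘L T = 0 := by
  constructor
  · intro h
    ext1 y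
    obtain ⟨x, hx, hxy⟩ := hT.exists_mem ((C.linearCoords n).surjective hw) y
    have h1 := (C.mem_distD_iff w hw x).1 (h hx)
    rw [linearCoords_apply] at hxy
    have h2 : (C.coframe w x).2 = (T y).2 := congrArg (fun z => z.2.2) hxy
    exact h2.symm.trans h1
  · intro h x hx
    rw [C.mem_distD_iff w hw]
    have h1 := (hT x).1 hx
    rw [linearCoords_apply] at h1
    have h2 := congrArg Prod.snd h1
    exact h2.trans (DFunLike.congr_fun h _)

/-- In coordinates in which the product of two real lines is horizontal, the integral elements
among the planes in `D` are the graphs of diagonal maps. -/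
theorem isIntegralElement_iff_of_graph {n : (ℂ × ℂ) ≃L[ℝ] E2 × (ℝ × ℝ)} {c₁ c₂ : ℂ} (h₁ : c₁ ≠ 0)
    (h₂ : c₂ ≠ 0) (hn : ∀ z, (n z).1 0 = (z.1 * c₁).re ∧
      (n z).1 1 = (z.2 * c₂).re ∧ (n z).2 = ((z.1 * c₁).im, (z.2 * c₂).im)) {w : J2} (hw : w ∈ W)
    {v : Submodule ℝ J2} {T : E2 →L[ℝ] (ℝ × ℝ) × (ℝ × (Fin 3 → ℝ))}
    (hT : IsGraphOf ((C.linearCoords n).coords w) v T) :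
    IsIntegralElement F w v ↔ v ≤ distD F w ∧
      ((T (EuclideanSpace.single 1 1)).1.1, (T (EuclideanSpace.single 0 1)).1.2) = (0 : ℝ × ℝ) := by
  rw [C.isIntegralElement_iff w hw]
  refine and_congr_right fun hv => ?_
  -- multiplication by `c` scales the form `Re ∧ Im` by `|c|²`
  have hmul : ∀ c z z' : ℂ, (z * c).re * (z' * c).im - (z' * c).re * (z * c).im =
      Complex.normSq c * (z.re * z'.im - z'.re * z.im) := by
    intro c z z'
    simp only [Complex.mul_re, Complex.mul_im, Complex.normSq_apply]
    ring
  have hexp : ∀ y : E2, T y = y 0 • T (EuclideanSpace.single 0 1) +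
      y 1 • T (EuclideanSpace.single 1 1) := by
    intro y
    rw [← map_smul, ← map_smul, ← map_add]
    congr 1
    ext i
    fin_cases i <;> simp
  have hcoord : ∀ x ∈ v, ∀ y : E2, ((C.linearCoords n).coords w x).1 = y →
      (((C.coframe w x).1.1 * c₁).re = y 0 ∧ ((C.coframe w x).1.2 * c₂).re = y 1) ∧
      ((C.coframe w x).1.1 * c₁).im = (T y).1.1 ∧ ((C.coframe w x).1.2 * c₂).im = (T y).1.2 := by
    rintro x hx y rfl
    have h1 := (hT x).1 hx
    rw [← h1, linearCoords_apply]
    obtain ⟨e1, e2, e3⟩ := hn (C.coframe w x).1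
    exact ⟨⟨e1.symm, e2.symm⟩, (congrArg Prod.fst e3).symm, (congrArg Prod.snd e3).symm⟩
  generalize hP : T (EuclideanSpace.single 0 1) = P at *
  generalize hQ : T (EuclideanSpace.single 1 1) = Q at *
  have hn1 := (Complex.normSq_pos.2 h₁).ne'
  have hn2 := (Complex.normSq_pos.2 h₂).ne'
  constructor
  · intro h
    obtain ⟨a, ha, hay⟩ := hT.exists_mem ((C.linearCoords n).surjective hw)
      (EuclideanSpace.single 0 1)
    obtain ⟨b, hb, hby⟩ := hT.exists_mem ((C.linearCoords n).surjective hw)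
      (EuclideanSpace.single 1 1)
    obtain ⟨⟨a1, a2⟩, a3, a4⟩ := hcoord a ha _ (congrArg Prod.fst hay)
    obtain ⟨⟨b1, b2⟩, b3, b4⟩ := hcoord b hb _ (congrArg Prod.fst hby)
    obtain ⟨e1, e2⟩ := h a ha b hb
    have f1 := hmul c₁ (C.coframe w a).1.1 (C.coframe w b).1.1
    have f2 := hmul c₂ (C.coframe w a).1.2 (C.coframe w b).1.2
    rw [e1, a1, a3, b1, b3] at f1
    rw [e2, a2, a4, b2, b4] at f2
    simp only [hP, hQ] at f1 f2
    simp at f1 f2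
    exact Prod.ext f1 f2
  · intro h a ha b hb
    have q : Q.1.1 = 0 := congrArg Prod.fst h
    have p : P.1.2 = 0 := congrArg Prod.snd h
    obtain ⟨⟨a1, a2⟩, a3, a4⟩ := hcoord a ha _ rfl
    obtain ⟨⟨b1, b2⟩, b3, b4⟩ := hcoord b hb _ rfl
    have f1 := hmul c₁ (C.coframe w a).1.1 (C.coframe w b).1.1
    have f2 := hmul c₂ (C.coframe w a).1.2 (C.coframe w b).1.2
    rw [a1, a3, b1, b3, hexp (((C.linearCoords n).coords w) a).1,
      hexp (((C.linearCoords n).coords w) b).1] at f1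
    rw [a2, a4, b2, b4, hexp (((C.linearCoords n).coords w) a).1,
      hexp (((C.linearCoords n).coords w) b).1] at f2
    simp only [Prod.fst_add, Prod.snd_add, Prod.smul_fst, Prod.smul_snd, smul_eq_mul, q, p] at f1 f2
    constructor
    · apply (mul_eq_zero.1 _).resolve_left hn1
      rw [← f1]; ring
    · apply (mul_eq_zero.1 _).resolve_left hn2
      rw [← f2]; ring

/-- On an integral element neither of the two complex coordinates vanishes identically. -/
theorem exists_coframe_ne_zero {w : J2} (hw : w ∈ W) {v : Plane}
    (hv : IsIntegralElement F w v.1) :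
    (∃ x ∈ v.1, (C.coframe w x).1.1 ≠ 0) ∧ ∃ x ∈ v.1, (C.coframe w x).1.2 ≠ 0 := by
  obtain ⟨hD, h⟩ := (C.isIntegralElement_iff w hw v.1).1 hv
  have hinj : ∀ x ∈ v.1, x ≠ 0 → (C.coframe w x).1.1 = 0 → (C.coframe w x).1.2 = 0 → False := by
    intro x hx hx0 h1 h2
    have h3 : C.coframe w x = 0 := Prod.ext (Prod.ext h1 h2) ((C.mem_distD_iff w hw x).1 (hD hx))
    apply hx0
    rw [← C.frame_coframe w hw x, h3, map_zero]
  obtain ⟨x, hx, hx0, h1⟩ := exists_ne_zero_of_wedge_eq_zero v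
    ((ContinuousLinearMap.fst ℝ ℂ ℂ ∘L ContinuousLinearMap.fst ℝ (ℂ × ℂ) _) ∘L C.coframe w)
    (fun a ha b hb => (h a ha b hb).1)
  obtain ⟨y, hy, hy0, h2⟩ := exists_ne_zero_of_wedge_eq_zero v
    ((ContinuousLinearMap.snd ℝ ℂ ℂ ∘L ContinuousLinearMap.fst ℝ (ℂ × ℂ) _) ∘L C.coframe w)
    (fun a ha b hb => (h a ha b hb).2)
  exact ⟨⟨y, hy, fun h3 => hinj y hy hy0 h3 h2⟩, ⟨x, hx, fun h3 => hinj x hx hx0 h1 h3⟩⟩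

/-- Linear coordinates adapted to a plane `v` in `D`; if `v` is an integral element, they are
compatible with the decomposition of `D` into two complex lines. -/
theorem exists_adapted_linearEquiv {w : J2} (hw : w ∈ W) {v : Plane} (hv : v.1 ≤ distD F w) :
    ∃ n : (ℂ × ℂ) ≃L[ℝ] E2 × (ℝ × ℝ), IsGraphOf ((C.linearCoords n).coords w) v.1 0 ∧
      (IsIntegralElement F w v.1 → ∃ c₁ c₂ : ℂ, c₁ ≠ 0 ∧ c₂ ≠ 0 ∧ ∀ z, (n z).1 0 = (z.1 * c₁).re ∧
      (n z).1 1 = (z.2 * c₂).re ∧ (n z).2 = ((z.1 * c₁).im, (z.2 * c₂).im)) := by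
  have hη : ∀ x ∈ v.1, (C.coframe w x).2 = 0 := fun x hx => (C.mem_distD_iff w hw x).1 (hv hx)
  by_cases hi : IsIntegralElement F w v.1
  · -- the real lines are those of the plane `v` itself
    obtain ⟨⟨a, ha, ha0⟩, ⟨b, hb, hb0⟩⟩ := C.exists_coframe_ne_zero hw hi
    obtain ⟨-, h⟩ := (C.isIntegralElement_iff w hw v.1).1 hi
    have h₁ : (starRingEnd ℂ) (C.coframe w a).1.1 ≠ 0 := by simpa using ha0
    have h₂ : (starRingEnd ℂ) (C.coframe w b).1.2 ≠ 0 := by simpa using hb0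
    obtain ⟨n, hn⟩ := exists_linearEquiv_mul h₁ h₂
    refine ⟨n, isGraphOf_zero_of_le ((C.linearCoords n).inv_coords w hw)
      ((C.linearCoords n).coords_inv w hw) fun x hx => ?_, fun _ => ⟨_, _, h₁, h₂, hn⟩⟩
    rw [linearCoords_apply, (hn _).2.2, hη x hx]
    have e1 := (h a ha x hx).1
    have e2 := (h b hb x hx).2
    refine Prod.ext (Prod.ext ?_ ?_) rfl
    · simp only [Complex.mul_im, Complex.conj_re, Complex.conj_im]
      exact Eq.trans (by ring) e1
    · simp only [Complex.mul_im, Complex.conj_re, Complex.conj_im]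
      exact Eq.trans (by ring) e2
  · let ζ : v.1 →ₗ[ℝ] ℂ × ℂ :=
      (ContinuousLinearMap.fst ℝ (ℂ × ℂ) _ ∘L C.coframe w).toLinearMap ∘ₗ v.1.subtype
    have hζ : Function.Injective ζ := by
      rw [injective_iff_map_eq_zero]
      rintro ⟨x, hx⟩ h0
      have h3 : C.coframe w x = 0 := Prod.ext h0 (hη x hx)
      apply Subtype.ext
      change x = 0
      rw [← C.frame_coframe w hw x, h3, map_zero]
    obtain ⟨n, hn⟩ := exists_linearEquiv_of_finrank_eq_two
      ((LinearMap.finrank_range_of_inj hζ).trans v.2)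
    refine ⟨n, isGraphOf_zero_of_le ((C.linearCoords n).inv_coords w hw)
      ((C.linearCoords n).coords_inv w hw) fun x hx => ?_, fun h => absurd h hi⟩
    rw [linearCoords_apply, hη x hx]
    exact Prod.ext (hn _ ⟨⟨x, hx⟩, rfl⟩) rfl

end AdaptedCoframe

theorem IsRegularAt.fderiv_ne_zero {F : J2 → ℝ} {w : J2} (h : IsRegularAt F w) :
    fderiv ℝ F w ≠ 0 := by
  intro h0
  apply h
  simp [partialDeriv, h0]

/-- The equation has a slice chart at each of its points. -/
theorem exists_sliceChart_equation {Ω : Set J2} {F : J2 → ℝ} (hF : IsHyperbolicEquation Ω F)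
    {w₀ : J2} (hw₀ : w₀ ∈ equation Ω F) :
    ∃ Φ : SliceChart 𝓘(ℝ, J2) (EuclideanSpace ℝ (Fin 7)) ℝ (equation Ω F), w₀ ∈ Φ.source := by
  obtain ⟨φ, h1, h2, h3, h4, h5⟩ := exists_chart_snd_eq hF.isOpen hF.smooth hw₀.1
    (hF.regular w₀ hw₀).fderiv_ne_zero
  exact ⟨⟨φ, h3.contMDiffOn, h4.contMDiffOn, fun w hw => by
    rw [h5 w hw]
    exact ⟨fun h => h.2, fun h => ⟨h2 hw, h⟩⟩⟩, h1⟩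

/-- The Grassmann bundle `J(D, 2)` has a slice chart at each of its points; at the points of the
prolongation it can be chosen such that the prolongation is a slice as well. -/
theorem exists_sliceChart_grassmannBundle {Ω : Set J2} {F : J2 → ℝ}
    (hF : IsHyperbolicEquation Ω F) {u₀ : J2 × Plane} (hu₀ : u₀ ∈ grassmannBundle Ω F) :
    ∃ Φ : SliceChart (𝓘(ℝ, J2).prod 𝓘(ℝ, E2 →L[ℝ] E6)) (EuclideanSpace ℝ (Fin 9) × (ℝ × ℝ))
      NormalModel (grassmannBundle Ω F), u₀ ∈ Φ.source ∧
      (u₀ ∈ prolongation Ω F → ∀ y ∈ Φ.source, y ∈ prolongation Ω F ↔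
        (Φ.toOpenPartialHomeomorph y).1.2 = 0 ∧ (Φ.toOpenPartialHomeomorph y).2 = 0) := by
  obtain ⟨hw₀, hv₀⟩ := hu₀
  obtain ⟨W, hW, hWΩ, hw₀W, ⟨C⟩⟩ := exists_adaptedCoframe hF hw₀
  obtain ⟨φ, h1, h2, h3, h4, h5⟩ := exists_chart_snd_eq hF.isOpen hF.smooth hw₀.1
    (hF.regular _ hw₀).fderiv_ne_zero
  obtain ⟨n, hn, hni⟩ := C.exists_adapted_linearEquiv hw₀W hv₀
  obtain ⟨Φ, hs, hΦ, hsm, hsm'⟩ :=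
    (C.linearCoords n).exists_bundleChart hW φ h3 h4 u₀.2
  obtain ⟨m, hm⟩ := exists_linearEquiv_flag
  have hmem : ∀ u ∈ Φ.source, u ∈ grassmannBundle Ω F ↔ (m (Φ u)).2 = 0 := by
    intro u hu
    obtain ⟨e1, e2⟩ := hΦ u hu
    rw [hs] at hu
    rw [(hm _).2, e1, h5 _ hu.1.1, Prod.ext_iff]
    refine and_congr ⟨fun h => h.2, fun h => ⟨hWΩ hu.1.2, h⟩⟩ (C.le_distD_iff hu.1.2 e2)
  refine ⟨⟨Φ.transHomeomorph m.toHomeomorph, m.contDiff.contMDiff.comp_contMDiffOn hsm,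
    hsm'.comp m.symm.contDiff.contMDiff.contMDiffOn fun _ h => h, hmem⟩, ?_, ?_⟩
  · change u₀ ∈ Φ.source
    rw [hs]
    exact ⟨⟨h1, hw₀W⟩, 0, hn⟩
  · intro hpr u hu
    obtain ⟨c₁, c₂, hc₁, hc₂, hnc⟩ := hni hpr.2
    change _ ↔ (m (Φ u)).1.2 = 0 ∧ (m (Φ u)).2 = 0
    rw [← hmem u hu, (hm _).1]
    obtain ⟨e1, e2⟩ := hΦ u hu
    have hu' : u ∈ Φ.source := hu
    rw [hs] at hu'
    have key := C.isIntegralElement_iff_of_graph hc₁ hc₂ hnc hu'.1.2 e2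
    constructor
    · intro h
      exact ⟨(key.1 h.2).2, prolongation_subset Ω F h⟩
    · rintro ⟨h, h'⟩
      exact ⟨h'.1, key.2 ⟨h'.2, h⟩⟩

/-! ### Real lines in the complex plane and points of the circle -/

/-- The vector `ζ` lies on the real line of `ℂ` labelled by `z`, the line spanned by the square
roots of `z`. This labelling identifies the projective line of `ℂ = ℝ²` with the circle. -/
def OnLine (z : Circle) (ζ : ℂ) : Prop := ζ ^ 2 = z * Complex.normSq ζ

theorem OnLine.coe_eq {z : Circle} {ζ : ℂ} (h : OnLine z ζ) (h0 : ζ ≠ 0) :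
    (z : ℂ) = ζ ^ 2 / Complex.normSq ζ := by
  rw [eq_div_iff (by simpa using h0)]
  exact h.symm

theorem OnLine.unique {z z' : Circle} {ζ : ℂ} (h : OnLine z ζ) (h' : OnLine z' ζ) (h0 : ζ ≠ 0) :
    z = z' :=
  Circle.ext ((h.coe_eq h0).trans (h'.coe_eq h0).symm)

theorem OnLine.smul {z : Circle} {ζ : ℂ} (h : OnLine z ζ) (r : ℝ) : OnLine z (r • ζ) := by
  unfold OnLine at *
  simp only [Complex.real_smul, map_mul, Complex.normSq_ofReal, Complex.ofReal_mul]
  linear_combination (r : ℂ) ^ 2 * h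

theorem exists_onLine {ζ : ℂ} (h0 : ζ ≠ 0) : ∃ z : Circle, OnLine z ζ := by
  have h1 : (Complex.normSq ζ : ℂ) ≠ 0 := by simpa using h0
  refine ⟨⟨ζ ^ 2 / Complex.normSq ζ, ?_⟩, ?_⟩
  · rw [← SetLike.mem_coe, Submonoid.coe_unitSphere, mem_sphere_zero_iff_norm, norm_div, norm_pow, Complex.norm_real, Real.norm_of_nonneg (Complex.normSq_nonneg _),
      Complex.normSq_eq_norm_sq]
    exact div_self (by simpa using h0)
  · change ζ ^ 2 = ζ ^ 2 / Complex.normSq ζ * Complex.normSq ζ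
    rw [div_mul_cancel₀ _ h1]

theorem OnLine.of_wedge_eq_zero {z : Circle} {ζ ζ' : ℂ} (h : OnLine z ζ) (h0 : ζ ≠ 0)
    (hw : ζ.re * ζ'.im - ζ'.re * ζ.im = 0) : OnLine z ζ' := by
  have h1 : (Complex.normSq ζ : ℂ) ≠ 0 := by simpa using h0
  have h2 : ζ' * (starRingEnd ℂ) ζ = ζ * (starRingEnd ℂ) ζ' := by
    apply Complex.ext <;> simp <;> linarith
  unfold OnLine at *
  apply mul_left_cancel₀ h1
  rw [mul_left_comm, ← mul_assoc, ← h, ← Complex.mul_conj, ← Complex.mul_conj]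
  linear_combination ζ * ζ' * h2

theorem OnLine.exists_smul {z : Circle} {h ζ : ℂ} (hh : OnLine z h) (h0 : h ≠ 0)
    (hζ : OnLine z ζ) : ∃ r : ℝ, ζ = r • h := by
  rcases eq_or_ne ζ 0 with rfl | hζ0
  · exact ⟨0, by simp⟩
  have h1 : (Complex.normSq h : ℂ) ≠ 0 := by simpa using h0
  have h2 : ζ * (starRingEnd ℂ) h = h * (starRingEnd ℂ) ζ := by
    apply mul_left_cancel₀ (mul_ne_zero hζ0 h0)
    unfold OnLine at hh hζ
    rw [← Complex.mul_conj] at hh hζ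
    linear_combination h * (starRingEnd ℂ) h * hζ - ζ * (starRingEnd ℂ) ζ * hh
  have h3 : (starRingEnd ℂ) (ζ * (starRingEnd ℂ) h) = ζ * (starRingEnd ℂ) h := by
    rw [map_mul, Complex.conj_conj, h2, mul_comm]
  obtain ⟨r, hr⟩ := Complex.conj_eq_iff_real.1 h3
  refine ⟨r / Complex.normSq h, ?_⟩
  rw [Complex.real_smul, Complex.ofReal_div, ← hr, ← Complex.mul_conj]
  rw [← Complex.mul_conj] at h1
  rw [div_mul_eq_mul_div, eq_div_iff h1]
  ring

theorem exists_ne_zero_onLine (z : Circle) : ∃ h : ℂ, h ≠ 0 ∧ OnLine z h := by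
  obtain ⟨h, hh⟩ := IsAlgClosed.exists_pow_nat_eq (z : ℂ) (n := 2) (by norm_num)
  have h1 : ‖h‖ = 1 := by
    have h2 : ‖h‖ ^ 2 = 1 := by rw [← norm_pow, hh, Circle.norm_coe]
    exact (pow_eq_one_iff_of_nonneg (norm_nonneg h) two_ne_zero).1 h2
  refine ⟨h, fun h0 => by simp [h0] at h1, ?_⟩
  rw [OnLine, hh, Complex.normSq_eq_norm_sq, h1]
  simp

/-- Near `z`, a nonzero vector on the line labelled by `z'` is `h + z' h̄`, where `h` is a vector on
the line labelled by `z`. -/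
theorem onLine_add_mul_conj (z : Circle) (h : ℂ) : OnLine z (h + z * (starRingEnd ℂ) h) := by
  have hz : (z : ℂ) * (starRingEnd ℂ) z = 1 := by
    rw [Complex.mul_conj, Circle.normSq_coe, Complex.ofReal_one]
  unfold OnLine
  rw [← Complex.mul_conj, map_add, map_mul, Complex.conj_conj]
  linear_combination (-(h + z * (starRingEnd ℂ) h)) * h * hz

theorem OnLine.add_mul_conj_self {z : Circle} {h : ℂ} (hh : OnLine z h) (h0 : h ≠ 0) :
    h + z * (starRingEnd ℂ) h = 2 * h := by
  unfold OnLine at hh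
  rw [← Complex.mul_conj] at hh
  apply mul_left_cancel₀ h0
  linear_combination -hh

theorem contMDiff_coe_circle : ContMDiff (𝓡 1) 𝓘(ℝ, ℂ) ∞ (fun z : Circle => (z : ℂ)) :=
  have : Fact (Module.finrank ℝ ℂ = 1 + 1) := finrank_real_complex_fact'
  contMDiff_coe_sphere (E := ℂ) (n := 1)

/-- A map to the circle is smooth if it is smooth as a map to `ℂ`. -/
theorem contMDiffAt_circle_of_coe {E₀ : Type*} [NormedAddCommGroup E₀] [NormedSpace ℝ E₀]
    {H₀ : Type*} [TopologicalSpace H₀] {I₀ : ModelWithCorners ℝ E₀ H₀}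
    {N : Type*} [TopologicalSpace N] [ChartedSpace H₀ N] {f : N → Circle} {n : N}
    (hf : ContMDiffAt I₀ 𝓘(ℝ, ℂ) ∞ (fun m => (f m : ℂ)) n) : ContMDiffAt I₀ (𝓡 1) ∞ f n := by
  -- near `n`, `f` is `f n` times the exponential of a logarithm of `f / f n`
  have h1 : f = fun m => f n * Circle.exp (Complex.log ((f n : ℂ)⁻¹ * f m)).im := by
    ext1 m
    rw [Complex.log_im]
    have h2 : (f n : ℂ)⁻¹ * f m = ((f n)⁻¹ * f m : Circle) := by simp
    rw [h2, Circle.exp_arg]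
    simp
  have h3 : ContMDiffAt I₀ 𝓘(ℝ, ℂ) ∞ (fun m => (f n : ℂ)⁻¹ * f m) n :=
    (contDiff_const.mul contDiff_id : ContDiff ℝ ∞ fun x : ℂ => (f n : ℂ)⁻¹ * x).contMDiff.contMDiffAt.comp
      n hf
  have h4 : ContDiffAt ℝ ∞ (fun x : ℂ => (Complex.log x).im) ((f n : ℂ)⁻¹ * f n) := by
    have h5 : (f n : ℂ)⁻¹ * f n = 1 := inv_mul_cancel₀ (Circle.coe_ne_zero _)
    rw [h5]
    exact Complex.imCLM.contDiff.contDiffAt.comp _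
      ((Complex.contDiffAt_log (by simp)).restrict_scalars ℝ)
  have h6 : ContMDiffAt I₀ (𝓡 1) ∞
      (fun m => Circle.exp (Complex.log ((f n : ℂ)⁻¹ * f m)).im) n :=
    contMDiff_circleExp.contMDiffAt.comp n (ContMDiffAt.comp n (g := fun x : ℂ => (Complex.log x).im) h4.contMDiffAt h3)
  rw [h1]
  have : LieGroup (𝓡 1) ∞ Circle := inferInstance
  exact contMDiffAt_const.mul h6

/-- The label of the line `ζ(v)`. -/
noncomputable def lineLabel (ζ : J2 →L[ℝ] ℂ) (v : Submodule ℝ J2) : Circle :=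
  Classical.epsilon fun z => ∀ x ∈ v, OnLine z (ζ x)

theorem onLine_lineLabel {ζ : J2 →L[ℝ] ℂ} {v : Submodule ℝ J2}
    (h : ∀ a ∈ v, ∀ b ∈ v, (ζ a).re * (ζ b).im - (ζ b).re * (ζ a).im = 0)
    (h0 : ∃ x ∈ v, ζ x ≠ 0) {x : J2} (hx : x ∈ v) : OnLine (lineLabel ζ v) (ζ x) := by
  obtain ⟨a, ha, ha0⟩ := h0
  obtain ⟨z, hz⟩ := exists_onLine ha0
  exact Classical.epsilon_spec (p := fun z => ∀ x ∈ v, OnLine z (ζ x))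
    ⟨z, fun b hb => hz.of_wedge_eq_zero ha0 (h a ha b hb)⟩ x hx

/-! ### The torus bundle of integral elements -/

/-- The linear map with range `A' (ℝ h.1 × ℝ h.2 × 0)`. -/
noncomputable def torusFrame (A' : Cof →L[ℝ] J2) (h : ℂ × ℂ) : E2 →L[ℝ] J2 :=
  A' ∘L (ContinuousLinearMap.inl ℝ (ℂ × ℂ) (ℝ × (Fin 3 → ℝ)) ∘L
    (((EuclideanSpace.proj 0 : E2 →L[ℝ] ℝ).smulRight h.1).prod
      ((EuclideanSpace.proj 1 : E2 →L[ℝ] ℝ).smulRight h.2)))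

theorem torusFrame_apply (A' : Cof →L[ℝ] J2) (h : ℂ × ℂ) (y : E2) :
    torusFrame A' h y = A' ((y 0 • h.1, y 1 • h.2), 0) := by
  simp [torusFrame]

theorem contMDiffAt_torusFrame {E₀ : Type*} [NormedAddCommGroup E₀] [NormedSpace ℝ E₀]
    {H₀ : Type*} [TopologicalSpace H₀] {I₀ : ModelWithCorners ℝ E₀ H₀}
    {N : Type*} [TopologicalSpace N] [ChartedSpace H₀ N] {A' : N → (Cof →L[ℝ] J2)}
    {h : N → ℂ × ℂ} {n : N} (hA' : ContMDiffAt I₀ 𝓘(ℝ, Cof →L[ℝ] J2) ∞ A' n)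
    (hh : ContMDiffAt I₀ 𝓘(ℝ, ℂ × ℂ) ∞ h n) :
    ContMDiffAt I₀ 𝓘(ℝ, E2 →L[ℝ] J2) ∞ (fun m => torusFrame (A' m) (h m)) n := by
  have h1 : ContDiff ℝ ∞ fun h : ℂ × ℂ =>
      ContinuousLinearMap.inl ℝ (ℂ × ℂ) (ℝ × (Fin 3 → ℝ)) ∘L
        (((EuclideanSpace.proj 0 : E2 →L[ℝ] ℝ).smulRight h.1).prod
          ((EuclideanSpace.proj 1 : E2 →L[ℝ] ℝ).smulRight h.2)) := by
    rw [contDiff_clm_apply_iff]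
    intro y
    have h2 : ContDiff ℝ ∞ fun h : ℂ × ℂ =>
      ContinuousLinearMap.inl ℝ (ℂ × ℂ) (ℝ × (Fin 3 → ℝ)) (y 0 • h.1, y 1 • h.2) :=
      (ContinuousLinearMap.contDiff _).comp
        ((contDiff_fst.const_smul (y 0)).prodMk (contDiff_snd.const_smul (y 1)))
    exact h2
  exact hA'.clm_comp (h1.contMDiff.contMDiffAt.comp n hh)

namespace AdaptedCoframe

variable {F : J2 → ℝ} {W : Set J2} (C : AdaptedCoframe F W)

/-- The first pair of characteristic covectors. -/
noncomputable def fstCoord (w : J2) : J2 →L[ℝ] ℂ :=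
  (ContinuousLinearMap.fst ℝ ℂ ℂ ∘L ContinuousLinearMap.fst ℝ (ℂ × ℂ) _) ∘L C.coframe w

/-- The second pair of characteristic covectors. -/
noncomputable def sndCoord (w : J2) : J2 →L[ℝ] ℂ :=
  (ContinuousLinearMap.snd ℝ ℂ ℂ ∘L ContinuousLinearMap.fst ℝ (ℂ × ℂ) _) ∘L C.coframe w

theorem contDiffOn_fstCoord : ContDiffOn ℝ ∞ C.fstCoord W :=
  contDiffOn_const.clm_comp C.contDiffOn_coframe

theorem contDiffOn_sndCoord : ContDiffOn ℝ ∞ C.sndCoord W :=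
  contDiffOn_const.clm_comp C.contDiffOn_coframe

theorem torusFrame_injective {w : J2} (hw : w ∈ W) {h : ℂ × ℂ} (h₁ : h.1 ≠ 0) (h₂ : h.2 ≠ 0) :
    Function.Injective (torusFrame (C.frame w) h) := by
  rw [injective_iff_map_eq_zero]
  intro y hy
  rw [torusFrame_apply] at hy
  have h3 := congrArg (C.coframe w) hy
  rw [C.coframe_frame w hw, map_zero] at h3
  have e1 : y 0 • h.1 = 0 := congrArg (fun z => z.1.1) h3
  have e2 : y 1 • h.2 = 0 := congrArg (fun z => z.1.2) h3
  ext i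
  fin_cases i
  · exact (smul_eq_zero.1 e1).resolve_right h₁
  · exact (smul_eq_zero.1 e2).resolve_right h₂

/-- The planes of the two-parameter family are described by the labels of their two lines alone, and
do not depend on the choice of the vectors `h.1` and `h.2` on them. -/
theorem mem_range_torusFrame_iff {w : J2} (hw : w ∈ W) {h : ℂ × ℂ} (h₁ : h.1 ≠ 0) (h₂ : h.2 ≠ 0)
    {z : Circle × Circle} (hz₁ : OnLine z.1 h.1) (hz₂ : OnLine z.2 h.2) (x : J2) :
    x ∈ (torusFrame (C.frame w) h).range ↔
      x ∈ distD F w ∧ OnLine z.1 (C.fstCoord w x) ∧ OnLine z.2 (C.sndCoord w x) := by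
  rw [C.mem_distD_iff w hw]
  constructor
  · rintro ⟨y, rfl⟩
    have h3 : C.coframe w (torusFrame (C.frame w) h y) = ((y 0 • h.1, y 1 • h.2), 0) := by
      rw [torusFrame_apply, C.coframe_frame w hw]
    refine ⟨congrArg Prod.snd h3, ?_, ?_⟩
    · have h4 : C.fstCoord w (torusFrame (C.frame w) h y) = y 0 • h.1 :=
        congrArg (fun z => z.1.1) h3
      exact h4 ▸ hz₁.smul _
    · have h4 : C.sndCoord w (torusFrame (C.frame w) h y) = y 1 • h.2 :=
        congrArg (fun z => z.1.2) h3
      exact h4 ▸ hz₂.smul _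
  · rintro ⟨h3, h4, h5⟩
    obtain ⟨r, hr⟩ := hz₁.exists_smul h₁ h4
    obtain ⟨s, hs⟩ := hz₂.exists_smul h₂ h5
    refine ⟨!₂[r, s], (torusFrame_apply _ _ _).trans ?_⟩
    have h6 : C.coframe w x = ((r • h.1, s • h.2), 0) := Prod.ext (Prod.ext hr hs) h3
    rw [← C.frame_coframe w hw x, h6]
    simp

/-- The planes of the two-parameter family are integral elements. -/
theorem isIntegralElement_range_torusFrame {w : J2} (hw : w ∈ W) (h : ℂ × ℂ) :
    IsIntegralElement F w (torusFrame (C.frame w) h).range := by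
  rw [C.isIntegralElement_iff w hw]
  have h3 : ∀ y, C.coframe w (torusFrame (C.frame w) h y) = ((y 0 • h.1, y 1 • h.2), 0) := by
    intro y
    rw [torusFrame_apply, C.coframe_frame w hw]
  constructor
  · rintro _ ⟨y, rfl⟩
    exact (C.mem_distD_iff w hw _).2 (congrArg Prod.snd (h3 y))
  · rintro _ ⟨y, rfl⟩ _ ⟨y', rfl⟩
    have e1 := h3 y
    have e2 := h3 y'
    constructor
    · change (C.coframe w (torusFrame (C.frame w) h y)).1.1.re *
        (C.coframe w (torusFrame (C.frame w) h y')).1.1.im -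
        (C.coframe w (torusFrame (C.frame w) h y')).1.1.re *
        (C.coframe w (torusFrame (C.frame w) h y)).1.1.im = 0
      rw [e1, e2]
      simp
      ring
    · change (C.coframe w (torusFrame (C.frame w) h y)).1.2.re *
        (C.coframe w (torusFrame (C.frame w) h y')).1.2.im -
        (C.coframe w (torusFrame (C.frame w) h y')).1.2.re *
        (C.coframe w (torusFrame (C.frame w) h y)).1.2.im = 0
      rw [e1, e2]
      simp
      ring

/-- The pair of points of the circle labelling an integral element. -/
noncomputable def label (u : J2 × Plane) : Circle × Circle :=
  (lineLabel (C.fstCoord u.1) u.2.1, lineLabel (C.sndCoord u.1) u.2.1)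

theorem onLine_label {u : J2 × Plane} (hw : u.1 ∈ W) (hv : IsIntegralElement F u.1 u.2.1) {x : J2}
    (hx : x ∈ u.2.1) :
    OnLine (C.label u).1 (C.fstCoord u.1 x) ∧ OnLine (C.label u).2 (C.sndCoord u.1 x) := by
  obtain ⟨h1, h2⟩ := C.exists_coframe_ne_zero hw hv
  obtain ⟨-, h⟩ := (C.isIntegralElement_iff _ hw _).1 hv
  exact ⟨onLine_lineLabel (fun a ha b hb => (h a ha b hb).1) h1 hx,
    onLine_lineLabel (fun a ha b hb => (h a ha b hb).2) h2 hx⟩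

theorem exists_frame_labels (z : Circle × Circle) :
    ∃ h : ℂ × ℂ, (h.1 ≠ 0 ∧ h.2 ≠ 0) ∧ OnLine z.1 h.1 ∧ OnLine z.2 h.2 := by
  obtain ⟨h, h1, h2⟩ := exists_ne_zero_onLine z.1
  obtain ⟨h', h1', h2'⟩ := exists_ne_zero_onLine z.2
  exact ⟨(h, h'), ⟨h1, h1'⟩, h2, h2'⟩

/-- The integral element with given labels at the point `w`; the plane `v₀` is a junk value. -/
noncomputable def planeOfLabel (v₀ : Plane) (y : J2 × (Circle × Circle)) : J2 × Plane :=
  (y.1, planeOfRange v₀ (torusFrame (C.frame y.1) (exists_frame_labels y.2).choose))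

theorem mem_planeOfLabel_iff (v₀ : Plane) {y : J2 × (Circle × Circle)} (hw : y.1 ∈ W) (x : J2) :
    x ∈ (C.planeOfLabel v₀ y).2.1 ↔
      x ∈ distD F y.1 ∧ OnLine y.2.1 (C.fstCoord y.1 x) ∧ OnLine y.2.2 (C.sndCoord y.1 x) := by
  obtain ⟨⟨h1, h2⟩, h3, h4⟩ := (exists_frame_labels y.2).choose_spec
  rw [planeOfLabel, coe_planeOfRange v₀ (C.torusFrame_injective hw h1 h2)]
  exact C.mem_range_torusFrame_iff hw h1 h2 h3 h4 x

theorem isIntegralElement_planeOfLabel (v₀ : Plane) {y : J2 × (Circle × Circle)} (hw : y.1 ∈ W) :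
    IsIntegralElement F y.1 (C.planeOfLabel v₀ y).2.1 := by
  obtain ⟨⟨h1, h2⟩, h3, h4⟩ := (exists_frame_labels y.2).choose_spec
  rw [planeOfLabel, coe_planeOfRange v₀ (C.torusFrame_injective hw h1 h2)]
  exact C.isIntegralElement_range_torusFrame hw _

theorem label_planeOfLabel (v₀ : Plane) {y : J2 × (Circle × Circle)} (hw : y.1 ∈ W) :
    C.label (C.planeOfLabel v₀ y) = y.2 := by
  have hi := C.isIntegralElement_planeOfLabel v₀ hw
  obtain ⟨⟨a, ha, ha0⟩, ⟨b, hb, hb0⟩⟩ := C.exists_coframe_ne_zero hw hi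
  have h1 := (C.onLine_label (u := C.planeOfLabel v₀ y) hw hi ha).1
  have h2 := (C.onLine_label (u := C.planeOfLabel v₀ y) hw hi hb).2
  have h3 := ((C.mem_planeOfLabel_iff v₀ hw a).1 ha).2.1
  have h4 := ((C.mem_planeOfLabel_iff v₀ hw b).1 hb).2.2
  exact Prod.ext (h1.unique h3 ha0) (h2.unique h4 hb0)

theorem planeOfLabel_label (v₀ : Plane) {u : J2 × Plane} (hw : u.1 ∈ W)
    (hu : IsIntegralElement F u.1 u.2.1) : C.planeOfLabel v₀ (u.1, C.label u) = u := by
  refine Prod.ext rfl (Subtype.ext (Submodule.eq_of_le_of_finrank_eq ?_ ?_).symm)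
  · intro x hx
    rw [C.mem_planeOfLabel_iff v₀ hw]
    exact ⟨((C.isIntegralElement_iff _ hw _).1 hu).1 hx, C.onLine_label hw hu hx⟩
  · rw [u.2.2, (C.planeOfLabel v₀ (u.1, C.label u)).2.2]

section Smooth

variable {E₀ : Type*} [NormedAddCommGroup E₀] [NormedSpace ℝ E₀]
  {H₀ : Type*} [TopologicalSpace H₀] {I₀ : ModelWithCorners ℝ E₀ H₀}
  {N : Type*} [TopologicalSpace N] [ChartedSpace H₀ N]

/-- The label is smooth because it is `ζ(x)² / |ζ(x)|²` for any smooth choice of a vector `x` of the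
plane with `ζ(x) ≠ 0`. -/
theorem contMDiffAt_lineLabel {ζ : N → (J2 →L[ℝ] ℂ)} {v : N → Plane} {n : N}
    (hζ : ContMDiffAt I₀ 𝓘(ℝ, J2 →L[ℝ] ℂ) ∞ ζ n)
    (hv : ContMDiffAt I₀ 𝓘(ℝ, E2 →L[ℝ] E6) ∞ v n)
    (h : ∀ᶠ m in nhds n, ∀ x ∈ (v m).1, OnLine (lineLabel (ζ m) (v m).1) (ζ m x))
    (h0 : ∃ x ∈ (v n).1, ζ n x ≠ 0) :
    ContMDiffAt I₀ (𝓡 1) ∞ (fun m => lineLabel (ζ m) (v m).1) n := by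
  obtain ⟨B, hB, hBr⟩ := exists_smooth_frame (v n)
  obtain ⟨x, hx, hx0⟩ := h0
  rw [hBr.self_of_nhds] at hx
  obtain ⟨y, rfl⟩ := hx
  have h1 : ContMDiffAt I₀ 𝓘(ℝ, ℂ) ∞ (fun m => ζ m (B (v m) y)) n :=
    hζ.clm_apply ((hB.comp n hv).clm_apply contMDiffAt_const)
  have hne : ∀ᶠ m in nhds n, ζ m (B (v m) y) ≠ 0 :=
    h1.continuousAt.eventually (isOpen_compl_singleton.mem_nhds hx0)
  have h2 : ContDiffAt ℝ ∞ (fun c : ℂ => c ^ 2 / (Complex.normSq c : ℂ)) (ζ n (B (v n) y)) := by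
    have h3 : ContDiff ℝ ∞ fun c : ℂ => (Complex.normSq c : ℂ) := by
      simp_rw [← Complex.mul_conj]
      exact contDiff_id.mul Complex.conjCLE.contDiff
    have h4 : (Complex.normSq (ζ n (B (v n) y)) : ℂ) ≠ 0 := by
      rw [Ne, Complex.ofReal_eq_zero, Complex.normSq_eq_zero]
      exact hx0
    have h5 : ContDiffAt ℝ ∞ (fun c : ℂ => (Complex.normSq c : ℂ)⁻¹) (ζ n (B (v n) y)) :=
      h3.contDiffAt.inv h4
    exact (contDiff_id.pow 2).contDiffAt.mul h5
  apply contMDiffAt_circle_of_coe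
  refine (ContMDiffAt.comp n (g := fun c : ℂ => c ^ 2 / (Complex.normSq c : ℂ))
    h2.contMDiffAt h1).congr_of_eventuallyEq ?_
  filter_upwards [h, hne, hv.continuousAt.eventually hBr] with m h5 h6 h7
  exact (h5 _ (by rw [h7]; exact ⟨y, rfl⟩)).coe_eq h6

theorem contMDiffAt_label (hW : IsOpen W) {u : N → J2 × Plane} {n : N}
    (hu : ContMDiffAt I₀ (𝓘(ℝ, J2).prod 𝓘(ℝ, E2 →L[ℝ] E6)) ∞ u n) (hw : (u n).1 ∈ W)
    (hi : ∀ m, IsIntegralElement F (u m).1 (u m).2.1) :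
    ContMDiffAt I₀ ((𝓡 1).prod (𝓡 1)) ∞ (fun m => C.label (u m)) n := by
  have h1 : ContMDiffAt I₀ 𝓘(ℝ, J2) ∞ (fun m => (u m).1) n := contMDiffAt_fst.comp n hu
  have h2 : ContMDiffAt I₀ 𝓘(ℝ, E2 →L[ℝ] E6) ∞ (fun m => (u m).2) n := contMDiffAt_snd.comp n hu
  have hev : ∀ᶠ m in nhds n, (u m).1 ∈ W := h1.continuousAt.eventually (hW.mem_nhds hw)
  obtain ⟨h3, h4⟩ := C.exists_coframe_ne_zero hw (hi n)
  refine ContMDiffAt.prodMk ?_ ?_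
  · refine contMDiffAt_lineLabel
      (ContMDiffAt.comp n (g := C.fstCoord)
        (C.contDiffOn_fstCoord.contDiffAt (hW.mem_nhds hw)).contMDiffAt h1) h2 ?_ h3
    filter_upwards [hev] with m hm x hx
    exact (C.onLine_label hm (hi m) hx).1
  · refine contMDiffAt_lineLabel
      (ContMDiffAt.comp n (g := C.sndCoord)
        (C.contDiffOn_sndCoord.contDiffAt (hW.mem_nhds hw)).contMDiffAt h1) h2 ?_ h4
    filter_upwards [hev] with m hm x hx
    exact (C.onLine_label hm (hi m) hx).2

theorem contMDiffAt_planeOfLabel (hW : IsOpen W) (v₀ : Plane) {w : N → J2}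
    {z : N → Circle × Circle} {n : N} (hw : ContMDiffAt I₀ 𝓘(ℝ, J2) ∞ w n)
    (hz : ContMDiffAt I₀ ((𝓡 1).prod (𝓡 1)) ∞ z n) (hwW : w n ∈ W) :
    ContMDiffAt I₀ (𝓘(ℝ, J2).prod 𝓘(ℝ, E2 →L[ℝ] E6)) ∞
      (fun m => C.planeOfLabel v₀ (w m, z m)) n := by
  have hev : ∀ᶠ m in nhds n, w m ∈ W := hw.continuousAt.eventually (hW.mem_nhds hwW)
  obtain ⟨h, ⟨h1, h2⟩, h3, h4⟩ := exists_frame_labels (z n)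
  have hlift : ∀ c : ℂ, ContMDiff 𝓘(ℝ, ℂ) 𝓘(ℝ, ℂ) ∞
      (fun x : ℂ => c + x * (starRingEnd ℂ) c) := fun c =>
    (contDiff_const.add (contDiff_id.mul contDiff_const)).contMDiff
  have e1 : ContMDiffAt I₀ 𝓘(ℝ, ℂ) ∞ (fun m => h.1 + ((z m).1 : ℂ) * (starRingEnd ℂ) h.1) n :=
    (hlift h.1).contMDiffAt.comp n (contMDiff_coe_circle.contMDiffAt.comp n
      (contMDiffAt_fst.comp n hz))
  have e2 : ContMDiffAt I₀ 𝓘(ℝ, ℂ) ∞ (fun m => h.2 + ((z m).2 : ℂ) * (starRingEnd ℂ) h.2) n :=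
    (hlift h.2).contMDiffAt.comp n (contMDiff_coe_circle.contMDiffAt.comp n
      (contMDiffAt_snd.comp n hz))
  have e1' : ∀ᶠ m in nhds n, h.1 + ((z m).1 : ℂ) * (starRingEnd ℂ) h.1 ≠ 0 := by
    refine e1.continuousAt.eventually (isOpen_compl_singleton.mem_nhds fun h0 => ?_)
    exact mul_ne_zero two_ne_zero h1 ((h3.add_mul_conj_self h1).symm.trans h0)
  have e2' : ∀ᶠ m in nhds n, h.2 + ((z m).2 : ℂ) * (starRingEnd ℂ) h.2 ≠ 0 := by
    refine e2.continuousAt.eventually (isOpen_compl_singleton.mem_nhds fun h0 => ?_)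
    exact mul_ne_zero two_ne_zero h2 ((h4.add_mul_conj_self h2).symm.trans h0)
  have hfr : ContMDiffAt I₀ 𝓘(ℝ, Cof →L[ℝ] J2) ∞ (fun m => C.frame (w m)) n :=
    (C.contDiffOn_frame.contDiffAt (hW.mem_nhds hwW)).contMDiffAt.comp n hw
  refine hw.prodMk (contMDiffAt_plane_of_range
    (contMDiffAt_torusFrame hfr (e1.prodMk_space e2)) ?_)
  filter_upwards [hev, e1', e2'] with m m1 m2 m3
  ext x
  rw [C.mem_range_torusFrame_iff (z := z m) m1 m2 m3 (onLine_add_mul_conj _ _)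
    (onLine_add_mul_conj _ _)]
  exact C.mem_planeOfLabel_iff v₀ (y := (w m, z m)) m1 x

end Smooth

end AdaptedCoframe

theorem nonempty_plane : Nonempty Plane := by
  let e : J2 ≃ₗ[ℝ] E2 × E6 := LinearEquiv.ofFinrankEq _ _ (by simp)
  exact ⟨⟨_, finrank_planeGraph e.toContinuousLinearEquiv 0⟩⟩

theorem isSmoothFiberBundle_prolongationProj {Ω : Set J2} {F : J2 → ℝ}
    (hF : IsHyperbolicEquation Ω F) [ChartedSpace (EuclideanSpace ℝ (Fin 7)) (equation Ω F)]
    [ChartedSpace (EuclideanSpace ℝ (Fin 9)) (prolongation Ω F)]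
    (hR : IsImmersion (𝓡 7) 𝓘(ℝ, J2) ∞ (Subtype.val : equation Ω F → J2))
    (hP : IsImmersion (𝓡 9) (𝓘(ℝ, J2).prod 𝓘(ℝ, E2 →L[ℝ] E6)) ∞
      (Subtype.val : prolongation Ω F → J2 × Plane)) :
    IsSmoothFiberBundle (𝓡 9) (𝓡 7) ((𝓡 1).prod (𝓡 1)) (Circle × Circle)
      (prolongationProj Ω F) := by
  classical
  intro b
  obtain ⟨W, hW, hWΩ, hb, ⟨C⟩⟩ := exists_adaptedCoframe hF b.2
  obtain ⟨v₀⟩ := nonempty_plane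
  let U : Set (equation Ω F) := Subtype.val ⁻¹' W
  have hU : IsOpen U := hW.preimage continuous_subtype_val
  have hmem : ∀ y : equation Ω F × (Circle × Circle), y.1 ∈ U →
      C.planeOfLabel v₀ (y.1.1, y.2) ∈ prolongation Ω F := fun y hy =>
    ⟨y.1.2, C.isIntegralElement_planeOfLabel v₀ (y := (y.1.1, y.2)) hy⟩
  let f : prolongation Ω F → equation Ω F × (Circle × Circle) := fun u =>
    (prolongationProj Ω F u, C.label u.1)
  -- outside the domain of the coframe a constant is used
  let g : equation Ω F × (Circle × Circle) → prolongation Ω F := fun y =>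
    if h : y.1 ∈ U then ⟨_, hmem y h⟩ else ⟨_, hmem (b, y.2) hb⟩
  have hg : ∀ y : equation Ω F × (Circle × Circle), y.1 ∈ U →
      (g y : J2 × Plane) = C.planeOfLabel v₀ (y.1.1, y.2) := fun y hy => by
    simp only [g, dif_pos hy]
  have hproj : Continuous (prolongationProj Ω F) :=
    (continuous_fst.comp continuous_subtype_val).subtype_mk _
  have hfs : ∀ u, prolongationProj Ω F u ∈ U →
      ContMDiffAt (𝓡 9) ((𝓡 7).prod ((𝓡 1).prod (𝓡 1))) ∞ f u := by
    intro u hu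
    have h1 : ContMDiffAt (𝓡 9) (𝓘(ℝ, J2).prod 𝓘(ℝ, E2 →L[ℝ] E6)) ∞
        (Subtype.val : prolongation Ω F → J2 × Plane) u := (hP.isImmersionAt u).contMDiffAt
    refine ContMDiffAt.prodMk ?_ ?_
    · exact (ContMDiffAt.iff_comp_isImmersionAt (hR.isImmersionAt _)).2
        ⟨hproj.continuousAt, contMDiffAt_fst.comp u h1⟩
    · exact C.contMDiffAt_label hW h1 hu fun m => m.2.2
  have hgs : ∀ y : equation Ω F × (Circle × Circle), y.1 ∈ U →
      ContMDiffAt ((𝓡 7).prod ((𝓡 1).prod (𝓡 1))) (𝓡 9) ∞ g y := by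
    intro y hy
    have h1 : ContMDiffAt ((𝓡 7).prod ((𝓡 1).prod (𝓡 1))) 𝓘(ℝ, J2) ∞
        (fun y : equation Ω F × (Circle × Circle) => y.1.1) y :=
      (hR.isImmersionAt y.1).contMDiffAt.comp y contMDiffAt_fst
    have h2 := C.contMDiffAt_planeOfLabel hW v₀ h1 contMDiffAt_snd hy
    have h3 : ContMDiffAt ((𝓡 7).prod ((𝓡 1).prod (𝓡 1)))
        (𝓘(ℝ, J2).prod 𝓘(ℝ, E2 →L[ℝ] E6)) ∞ (Subtype.val ∘ g) y := by
      refine h2.congr_of_eventuallyEq ?_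
      filter_upwards [(hU.preimage continuous_fst).mem_nhds hy] with y' hy'
      exact hg y' hy'
    exact (ContMDiffAt.iff_comp_isImmersionAt (hP.isImmersionAt _)).2
      ⟨Topology.IsInducing.subtypeVal.continuousAt_iff.2 h3.continuousAt, h3⟩
  have hfs' : ContMDiffOn (𝓡 9) ((𝓡 7).prod ((𝓡 1).prod (𝓡 1))) ∞ f
    (prolongationProj Ω F ⁻¹' U) := fun u hu => (hfs u hu).contMDiffWithinAt
  have hgs' : ContMDiffOn ((𝓡 7).prod ((𝓡 1).prod (𝓡 1))) (𝓡 9) ∞ g (U ×ˢ Set.univ) :=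
    fun y hy => (hgs y hy.1).contMDiffWithinAt
  have hpg : ∀ y : equation Ω F × (Circle × Circle), y.1 ∈ U →
      prolongationProj Ω F (g y) = y.1 := fun y hy =>
    Subtype.ext (congrArg Prod.fst (hg y hy))
  let e : Bundle.Trivialization (Circle × Circle) (prolongationProj Ω F) :=
    { toFun := f
      invFun := g
      source := prolongationProj Ω F ⁻¹' U
      target := U ×ˢ Set.univ
      map_source' := fun u hu => ⟨hu, Set.mem_univ _⟩
      map_target' := fun y hy => by
        rw [Set.mem_preimage, hpg y hy.1]
        exact hy.1
      left_inv' := fun u hu => Subtype.ext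
        ((hg (f u) hu).trans (C.planeOfLabel_label v₀ hu u.2.2))
      right_inv' := fun y hy => by
        refine Prod.ext (hpg y hy.1) ?_
        change C.label (g y : J2 × Plane) = y.2
        rw [hg y hy.1]
        exact C.label_planeOfLabel v₀ (y := (y.1.1, y.2)) hy.1
      open_source := hU.preimage hproj
      open_target := hU.prod isOpen_univ
      continuousOn_toFun := hfs'.continuousOn
      continuousOn_invFun := hgs'.continuousOn
      baseSet := U
      open_baseSet := hU
      source_eq := rfl
      target_eq := rfl
      proj_toFun := fun _ _ => rfl }
  exact ⟨e, hb, hfs', hgs'⟩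


theorem finrank_continuousLinearMap (V V' : Type*) [NormedAddCommGroup V] [NormedSpace ℝ V]
    [FiniteDimensional ℝ V] [NormedAddCommGroup V'] [NormedSpace ℝ V'] [FiniteDimensional ℝ V'] :
    Module.finrank ℝ (V →L[ℝ] V') = Module.finrank ℝ V * Module.finrank ℝ V' := by
  rw [← (LinearMap.toContinuousLinearMap (𝕜 := ℝ) (E := V) (F' := V')).finrank_eq,
    Module.finrank_linearMap]

theorem nonempty_linearEquiv_of_finrank {V V' : Type*} [NormedAddCommGroup V] [NormedSpace ℝ V]
    [FiniteDimensional ℝ V] [NormedAddCommGroup V'] [NormedSpace ℝ V'] [FiniteDimensional ℝ V']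
    (h : Module.finrank ℝ V = Module.finrank ℝ V') : Nonempty (V ≃L[ℝ] V') :=
  ⟨(LinearEquiv.ofFinrankEq _ _ h).toContinuousLinearEquiv⟩

/-- The slice charts of `J(D, 2)`, with the coordinates along `J(D, 2)` collected in `ℝ¹¹`. -/
theorem exists_sliceChart_grassmannBundle_eleven {Ω : Set J2} {F : J2 → ℝ}
    (hF : IsHyperbolicEquation Ω F)
    (κ : (EuclideanSpace ℝ (Fin 9) × (ℝ × ℝ)) ≃L[ℝ] EuclideanSpace ℝ (Fin 11)) {u : J2 × Plane}
    (hu : u ∈ grassmannBundle Ω F) :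
    ∃ Φ : SliceChart (𝓘(ℝ, J2).prod 𝓘(ℝ, E2 →L[ℝ] E6)) (EuclideanSpace ℝ (Fin 11)) NormalModel
      (grassmannBundle Ω F), u ∈ Φ.source := by
  obtain ⟨Φ, hΦ, -⟩ := exists_sliceChart_grassmannBundle hF hu
  exact ⟨Φ.congr (grassmannBundle Ω F) (κ.prodCongr (.refl ℝ NormalModel))
    fun y hy => Φ.mem_iff y hy, hΦ⟩

theorem exists_sliceChart_prolongation {Ω : Set J2} {F : J2 → ℝ}
    (hF : IsHyperbolicEquation Ω F) {u : J2 × Plane} (hu : u ∈ prolongation Ω F) :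
    ∃ Φ : SliceChart (𝓘(ℝ, J2).prod 𝓘(ℝ, E2 →L[ℝ] E6)) (EuclideanSpace ℝ (Fin 9))
      ((ℝ × ℝ) × NormalModel) (prolongation Ω F), u ∈ Φ.source := by
  obtain ⟨Φ, hΦ, hΦ'⟩ := exists_sliceChart_grassmannBundle hF (prolongation_subset Ω F hu)
  refine ⟨Φ.congr (prolongation Ω F) (ContinuousLinearEquiv.prodAssoc ℝ _ _ _) fun y hy => ?_, hΦ⟩
  exact (hΦ' hu y hy).trans Prod.mk_eq_zero.symm

end JetPDE

theorem mainTheorem4 (Ω : Set J2) (F : J2 → ℝ) (hF : IsHyperbolicEquation Ω F) :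
    ∃ (_ : ChartedSpace (EuclideanSpace ℝ (Fin 7)) (equation Ω F))
      (_ : ChartedSpace (EuclideanSpace ℝ (Fin 11)) (grassmannBundle Ω F))
      (_ : ChartedSpace (EuclideanSpace ℝ (Fin 9)) (prolongation Ω F)),
      -- `R` is a smooth submanifold of the jet space
      (IsManifold (𝓡 7) ∞ (equation Ω F) ∧
        IsSmoothEmbedding (𝓡 7) 𝓘(ℝ, J2) ∞ (Subtype.val : equation Ω F → J2)) ∧
      -- `J(D, 2)` is a smooth submanifold of the Grassmann bundle of the jet space
      (IsManifold (𝓡 11) ∞ (grassmannBundle Ω F) ∧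
        IsSmoothEmbedding (𝓡 11) (𝓘(ℝ, J2).prod 𝓘(ℝ, E2 →L[ℝ] E6)) ∞
          (Subtype.val : grassmannBundle Ω F → J2 × Plane)) ∧
      -- `Σ(R)` is a smooth submanifold of `J(D, 2)`
      (IsManifold (𝓡 9) ∞ (prolongation Ω F) ∧
        IsSmoothEmbedding (𝓡 9) (𝓡 11) ∞ (Set.inclusion (prolongation_subset Ω F))) ∧
      -- `Σ(R) → R` is a smooth bundle with fibre the torus
      IsSmoothFiberBundle (𝓡 9) (𝓡 7) ((𝓡 1).prod (𝓡 1)) (Circle × Circle)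
        (prolongationProj Ω F) := by
  obtain ⟨κ⟩ := nonempty_linearEquiv_of_finrank (V := EuclideanSpace ℝ (Fin 9) × (ℝ × ℝ))
    (V' := EuclideanSpace ℝ (Fin 11)) (by simp)
  obtain ⟨cR⟩ := nonempty_linearEquiv_of_finrank (V := EuclideanSpace ℝ (Fin 7) × ℝ) (V' := J2)
    (by simp)
  obtain ⟨cJ⟩ := nonempty_linearEquiv_of_finrank (V := EuclideanSpace ℝ (Fin 11) × NormalModel)
    (V' := J2 × (E2 →L[ℝ] E6)) (by simp [finrank_continuousLinearMap])
  obtain ⟨cP⟩ := nonempty_linearEquiv_of_finrank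
    (V := EuclideanSpace ℝ (Fin 9) × ((ℝ × ℝ) × NormalModel))
    (V' := J2 × (E2 →L[ℝ] E6)) (by simp [finrank_continuousLinearMap])
  have hsR := fun w hw => exists_sliceChart_equation hF (w₀ := w) hw
  have hsJ := fun u hu => exists_sliceChart_grassmannBundle_eleven hF κ (u := u) hu
  have hsP := fun u hu => exists_sliceChart_prolongation hF (u := u) hu
  obtain ⟨iR, mR, aR⟩ := exists_chartedSpace_of_sliceChart hsR
  obtain ⟨iJ, mJ, aJ⟩ := exists_chartedSpace_of_sliceChart hsJ
  obtain ⟨iP, mP, aP⟩ := exists_chartedSpace_of_sliceChart hsP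
  have eR := isSmoothEmbedding_subtypeVal cR hsR aR
  have eP := isSmoothEmbedding_subtypeVal cP hsP aP
  refine ⟨iR, iJ, iP, ⟨mR, eR⟩, ⟨mJ, isSmoothEmbedding_subtypeVal cJ hsJ aJ⟩, ⟨mP, ?_⟩,
    isSmoothFiberBundle_prolongationProj hF eR.isImmersion eP.isImmersion⟩
  exact isSmoothEmbedding_inclusion (I₀ := 𝓘(ℝ, J2).prod 𝓘(ℝ, E2 →L[ℝ] E6)) _ (fun u hu => by
    obtain ⟨Φ, hΦ, hΦ'⟩ := exists_sliceChart_grassmannBundle hF (prolongation_subset Ω F hu)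
    exact ⟨Φ, hΦ, hΦ' hu⟩) aP κ aJ
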